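/- Let $(\mathcal C,\otimes,I)$ and $(\mathcal E,\bullet,I)$ be monoidal categories, and let $(T,\mu,\eta)$ be a bistrong graded monad on $\mathcal C$ with grades $\mathcal E$: a lax monoidal functor $T:\mathcal E\to[\mathcal C,\mathcal C]$, with unit $\eta:\mathrm{id}\Rightarrow T_I$ and multiplication $\mu_{e,e'}:T_{e'}\circ T_e\Rightarrow T_{e\bullet e'}$, together with, for every grade $e$, a left strength $t^e_{A,B}:A\otimes T_eB\to T_e(A\otimes B)$ and a right strength $s^e_{A,B}:T_eA\otimes B\to T_e(A\otimes B)$ (natural in $A$ and $B$ and compatible with the unitors and associator of $\mathcal C$) such that the two canonical maps $(A\otimes T_eB)\otimes C\to T_e(A\otimes(B\otimes C))$ are equal, and such that all $T_\gamma$, $\eta$ and $\mu_{e,e'}$ commute with both strengths. Let $\mathcal K_T$ be the Kleisli bicategory: its objects are those of $\mathcal C$; a 1-cell $A\to B$ is a pair $(e,\ f:A\to T_eB)$; a 2-cell $(e,f)\Rightarrow(e',f')$ is a morphism $\gamma:e\to e'$ of $\mathcal E$ with $T_\gamma(B)\circ f=f'$; the identity on $A$ is $(I,\eta_A)$, and the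 composite of $(e,f):A\to B$ with $(e',g):B\to C$ is $(e'\bullet e,\ \mu_{e',e}\circ T_e(g)\circ f)$. For $f\in\mathcal C(A,B)$ write $\widetilde f=(I,\eta_B\circ f)$ for the corresponding pure 1-cell. Then $\mathcal K_T$ has a canonical structure of a premonoidal bicategory, namely one such that: 1. the binoidal structure is given on objects by $\otimes$ and on 1-cells by $A\rtimes(e,g)=(e,\ t^e\circ(A\otimes g))$ and $(e,f)\ltimes B=(e,\ s^e\circ(f\otimes B))$, with $A\rtimes(-)$ and $(-)\ltimes B$ leaving the regrading $\gamma$ underlying a 2-cell unchanged (these are strict pseudofunctors); 2. the unit object is that of $\mathcal C$, and the structural adjoint equivalences are the pure 1-cells $\widetilde\lambda,\widetilde\rho,\widetilde\alpha$ given by the structural isomorphisms of $\mathcal C$, with inverses $\widetilde{\lambda^{-1}},\widetilde{\rho^{-1}},\widetilde{\alpha^{-1}}$; 3. the pseudonaturality 2-cells of these equivalences (for $\widetilde\alpha$, in each argument separately), and the 2-cells witnessing their centrality, at a 1-cell of grade $e$, are the canonical regradings $I\bullet e\cong e\bullet I$; 4. the structural 2-cells $\mathfrak p,\mathfrak m,\mathfrak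 l,\mathfrak r$ are the canonical regradings $(I\bullet I)\bullet I\cong I\bullet I$, $I\bullet I\cong I$, $I\cong I\bullet I$ and $I\cong I\bullet I$. Here a premonoidal bicategory is a bicategory $\mathcal B$ with pseudofunctors $A\rtimes(-)$ and $(-)\ltimes B$ that agree on objects, $A\rtimes B=A\ltimes B=AB$ (a binoidal bicategory), a unit object $I$, adjoint equivalences $\lambda_A:IA\to A$ and $\rho_A:AI\to A$ pseudonatural in $A$, adjoint equivalences $\alpha_{A,B,C}:(AB)C\to A(BC)$ pseudonatural in each argument separately, all of them equipped with the structure of central 1-cells, and invertible central 2-cells $$\mathfrak p:(A\rtimes\alpha)\circ\alpha\circ(\alpha\ltimes D)\Rightarrow\alpha\circ\alpha,\qquad \mathfrak m:(A\rtimes\lambda)\circ\alpha\Rightarrow\rho\ltimes B,\qquad \mathfrak l:\lambda\ltimes B\Rightarrow\lambda\circ\alpha,\qquad \mathfrak r:\rho\Rightarrow(A\rtimes\rho)\circ\alpha$$ that are modifications in each argument separately (using the centrality witnesses wherever the interchange 2-cells would be needed in a monoidal bicategory) and satisfy the equations between 2-cells of a monoidal bicategory, i.e. the associahedron equation and the equations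 relating $\mathfrak p$ with $\mathfrak m,\mathfrak l,\mathfrak r$ when one of the objects is $I$. A central 1-cell is a 1-cell $f:A\to A'$ with invertible 2-cells making the 1-cells $f\ltimes B$ the components of a pseudonatural transformation $A\rtimes(-)\Rightarrow A'\rtimes(-)$ and the 1-cells $B\rtimes f$ those of a pseudonatural transformation $(-)\ltimes A\Rightarrow(-)\ltimes A'$; a central 2-cell $\sigma$ is one for which $\sigma\ltimes B$ and $B\rtimes\sigma$ define modifications between these transformations. Composites of central 1-cells carry the composite witnesses, and $X\rtimes f$, $f\ltimes X$ (for $f$ central) carry the unique witnesses compatible with those of $f$ along $\alpha$. -/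

import Mathlib

universe w v u w' v' u' v₁ u₁ v₂ u₂

namespace PremonoidalBicat

open CategoryTheory

section Generalities

open Bicategory

variable {B : Type u} [Bicategory.{w, v} B] {C : Type u'} [Bicategory.{w', v'} C]

/-- A pseudofunctor `B ⥤ᵖ C` whose function on objects is the prescribed function `o`. -/
structure PseudofunctorOn (o : B → C) where
  map {a b : B} (f : a ⟶ b) : o a ⟶ o b
  map₂ {a b : B} {f g : a ⟶ b} (η : f ⟶ g) : map f ⟶ map g
  mapId (a : B) : map (𝟙 a) ≅ 𝟙 (o a)
  mapComp {a b c : B} (f : a ⟶ b) (g : b ⟶ c) : map (f ≫ g) ≅ map f ≫ map g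
  map₂_id {a b : B} (f : a ⟶ b) : map₂ (𝟙 f) = 𝟙 (map f)
  map₂_comp {a b : B} {f g h : a ⟶ b} (η : f ⟶ g) (θ : g ⟶ h) :
    map₂ (η ≫ θ) = map₂ η ≫ map₂ θ
  map₂_whisker_left {a b c : B} (f : a ⟶ b) {g h : b ⟶ c} (η : g ⟶ h) :
    map₂ (f ◁ η) = (mapComp f g).hom ≫ map f ◁ map₂ η ≫ (mapComp f h).inv
  map₂_whisker_right {a b c : B} {f g : a ⟶ b} (η : f ⟶ g) (h : b ⟶ c) :
    map₂ (η ▷ h) = (mapComp f h).hom ≫ map₂ η ▷ map h ≫ (mapComp g h).inv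
  map₂_associator {a b c d : B} (f : a ⟶ b) (g : b ⟶ c) (h : c ⟶ d) :
    map₂ (α_ f g h).hom = (mapComp (f ≫ g) h).hom ≫ (mapComp f g).hom ▷ map h ≫
      (α_ (map f) (map g) (map h)).hom ≫ map f ◁ (mapComp g h).inv ≫ (mapComp f (g ≫ h)).inv
  map₂_left_unitor {a b : B} (f : a ⟶ b) :
    map₂ (λ_ f).hom = (mapComp (𝟙 a) f).hom ≫ (mapId a).hom ▷ map f ≫ (λ_ (map f)).hom
  map₂_right_unitor {a b : B} (f : a ⟶ b) :
    map₂ (ρ_ f).hom = (mapComp f (𝟙 b)).hom ≫ map f ◁ (mapId b).hom ≫ (ρ_ (map f)).hom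

/-- The underlying pseudofunctor; its object function is `o` by definition. -/
def PseudofunctorOn.toPseudofunctor {o : B → C} (F : PseudofunctorOn o) : Pseudofunctor B C where
  obj := o
  map := F.map
  map₂ := F.map₂
  map₂_id := F.map₂_id
  map₂_comp := F.map₂_comp
  mapId := F.mapId
  mapComp := F.mapComp
  map₂_whisker_left := F.map₂_whisker_left
  map₂_whisker_right := F.map₂_whisker_right
  map₂_associator := F.map₂_associator
  map₂_left_unitor := F.map₂_left_unitor
  map₂_right_unitor := F.map₂_right_unitor

/-- A pseudofunctor acts on invertible 2-cells. -/
def PseudofunctorOn.map₂Iso {o : B → C} (F : PseudofunctorOn o) {a b : B} {f g : a ⟶ b}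
    (η : f ≅ g) : F.map f ≅ F.map g where
  hom := F.map₂ η.hom
  inv := F.map₂ η.inv
  hom_inv_id := by rw [← F.map₂_comp, η.hom_inv_id, F.map₂_id]
  inv_hom_id := by rw [← F.map₂_comp, η.inv_hom_id, F.map₂_id]

/-- The compositor of a pseudofunctor for three composable 1-cells. -/
def PseudofunctorOn.mapComp₃ {o : B → C} (F : PseudofunctorOn o) {a b c d : B}
    (f : a ⟶ b) (g : b ⟶ c) (h : c ⟶ d) :
    F.map (f ≫ g ≫ h) ≅ F.map f ≫ F.map g ≫ F.map h :=
  F.mapComp f (g ≫ h) ≪≫ whiskerLeftIso (F.map f) (F.mapComp g h)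

/-- The action of a pseudofunctor on 2-cells `f ≫ g ≅ k`, up to compositors. -/
def PseudofunctorOn.map₂₁ {o : B → C} (F : PseudofunctorOn o) {a b c : B}
    {f : a ⟶ b} {g : b ⟶ c} {k : a ⟶ c} (θ : f ≫ g ≅ k) : F.map f ≫ F.map g ≅ F.map k :=
  (F.mapComp f g).symm ≪≫ F.map₂Iso θ

/-- The action of a pseudofunctor on 2-cells `f ≫ g ≫ h ≅ k ≫ l`, up to compositors. -/
def PseudofunctorOn.map₃₂ {o : B → C} (F : PseudofunctorOn o) {a b c d e : B}
    {f : a ⟶ b} {g : b ⟶ c} {h : c ⟶ d} {k : a ⟶ e} {l : e ⟶ d} (θ : f ≫ g ≫ h ≅ k ≫ l) :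
    F.map f ≫ F.map g ≫ F.map h ≅ F.map k ≫ F.map l :=
  (F.mapComp₃ f g h).symm ≪≫ F.map₂Iso θ ≪≫ F.mapComp k l

/-- The laws making 1-cells `app a` with invertible 2-cells `nat f` a pseudonatural
transformation (see `IsPseudonatural.toStrongTrans`). -/
structure IsPseudonatural (F G : Pseudofunctor B C) (app : ∀ a : B, F.obj a ⟶ G.obj a)
    (nat : ∀ {a b : B} (f : a ⟶ b), F.map f ≫ app b ≅ app a ≫ G.map f) : Prop where
  naturality_naturality : ∀ {a b : B} {f g : a ⟶ b} (η : f ⟶ g),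
    F.map₂ η ▷ app b ≫ (nat g).hom = (nat f).hom ≫ app a ◁ G.map₂ η
  naturality_id : ∀ a : B,
    (nat (𝟙 a)).hom ≫ app a ◁ (G.mapId a).hom =
      (F.mapId a).hom ▷ app a ≫ (λ_ (app a)).hom ≫ (ρ_ (app a)).inv
  naturality_comp : ∀ {a b c : B} (f : a ⟶ b) (g : b ⟶ c),
    (nat (f ≫ g)).hom ≫ app a ◁ (G.mapComp f g).hom =
      (F.mapComp f g).hom ▷ app c ≫ (α_ _ _ _).hom ≫ F.map f ◁ (nat g).hom ≫
        (α_ _ _ _).inv ≫ (nat f).hom ▷ G.map g ≫ (α_ _ _ _).hom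

/-- Mathlib's pseudonatural transformation given by the data of `IsPseudonatural`. -/
def IsPseudonatural.toStrongTrans {F G : Pseudofunctor B C} {app : ∀ a : B, F.obj a ⟶ G.obj a}
    {nat : ∀ {a b : B} (f : a ⟶ b), F.map f ≫ app b ≅ app a ≫ G.map f}
    (h : IsPseudonatural F G app nat) : Pseudofunctor.StrongTrans F G where
  app := app
  naturality := nat
  naturality_naturality := h.naturality_naturality
  naturality_id := h.naturality_id
  naturality_comp := h.naturality_comp

/-- An invertible 2-cell filling a square of 1-cells. The pseudonaturality 2-cell of a
transformation `τ : F ⟹ G` at `f : x ⟶ y` is such a filler, with `top = F f`,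
`left = τ x`, `right = τ y`, `bot = G f`. -/
abbrev Sq {a b c d : B} (top : a ⟶ b) (left : a ⟶ c) (right : b ⟶ d) (bot : c ⟶ d) :=
  top ≫ right ≅ left ≫ bot

/-- Pasting of squares: the pseudonaturality 2-cell of a composite of transformations. -/
def Sq.paste {a b c d e f : B} {top : a ⟶ b} {l : a ⟶ c} {r : b ⟶ d} {mid : c ⟶ d}
    {l' : c ⟶ e} {r' : d ⟶ f} {bot : e ⟶ f} (s : Sq top l r mid) (s' : Sq mid l' r' bot) :
    Sq top (l ≫ l') (r ≫ r') bot :=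
  (α_ top r r').symm ≪≫ whiskerRightIso s r' ≪≫ α_ l mid r' ≪≫ whiskerLeftIso l s' ≪≫
    (α_ l l' bot).symm

/-- Replacing the vertical 1-cells of a square by isomorphic ones. -/
def Sq.conj {a b c d : B} {top : a ⟶ b} {l l' : a ⟶ c} {r r' : b ⟶ d} {bot : c ⟶ d}
    (s : Sq top l r bot) (i : l' ≅ l) (j : r' ≅ r) : Sq top l' r' bot :=
  whiskerLeftIso top j ≪≫ s ≪≫ (whiskerRightIso i bot).symm

/-- The image of a square under a pseudofunctor. -/
def Sq.map {o : B → C} (F : PseudofunctorOn o) {a b c d : B} {top : a ⟶ b} {l : a ⟶ c}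
    {r : b ⟶ d} {bot : c ⟶ d} (s : Sq top l r bot) :
    Sq (F.map top) (F.map l) (F.map r) (F.map bot) :=
  (F.mapComp top r).symm ≪≫ F.map₂Iso s ≪≫ F.mapComp l bot

/-- The modification equation: if `s` and `s'` are the pseudonaturality 2-cells at one 1-cell of
two transformations, and `σ`, `τ` are the components at the source and the target of that 1-cell
of a family of 2-cells between them, this is the equation in the definition of a modification. -/
def Sq.IsModif {a b c d : B} {top : a ⟶ b} {l l' : a ⟶ c} {r r' : b ⟶ d} {bot : c ⟶ d}
    (s : Sq top l r bot) (s' : Sq top l' r' bot) (σ : l ⟶ l') (τ : r ⟶ r') : Prop :=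
  top ◁ τ ≫ s'.hom = s.hom ≫ σ ▷ bot

/-- The equation `Sq.IsModif` for all 1-cells is the same as Mathlib's notion of modification. -/
theorem isModif_iff {F G : Pseudofunctor B C} (η θ : Pseudofunctor.StrongTrans F G) (σ : ∀ a, η.app a ⟶ θ.app a) :
    (∀ {a b : B} (f : a ⟶ b),
      Sq.IsModif (η.naturality f) (θ.naturality f) (σ a) (σ b)) ↔
    ∃ Γ : Pseudofunctor.StrongTrans.Modification η θ, Γ.app = σ := by
  constructor
  · intro h
    exact ⟨⟨σ, fun f => h f⟩, rfl⟩
  · rintro ⟨Γ, rfl⟩ a b f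
    exact Γ.naturality f

/-- Cancelling an equivalence on the right: the invertible 2-cell `u ≅ v` corresponding to an
invertible 2-cell `u ≫ e ≅ v ≫ e` under whiskering with the equivalence `e`. -/
def cancelRight {a b c : B} (e : b ≌ c) {f g : a ⟶ b} (θ : f ≫ e.hom ≅ g ≫ e.hom) : f ≅ g :=
  (ρ_ f).symm ≪≫ whiskerLeftIso f e.unit ≪≫ (α_ f e.hom e.inv).symm ≪≫
    whiskerRightIso θ e.inv ≪≫ α_ g e.hom e.inv ≪≫ whiskerLeftIso g e.unit.symm ≪≫ ρ_ g

/-- Cancelling an equivalence on the left. -/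
def cancelLeft {a b c : B} (e : a ≌ b) {f g : b ⟶ c} (θ : e.hom ≫ f ≅ e.hom ≫ g) : f ≅ g :=
  (λ_ f).symm ≪≫ whiskerRightIso e.counit.symm f ≪≫ α_ e.inv e.hom f ≪≫
    whiskerLeftIso e.inv θ ≪≫ (α_ e.inv e.hom g).symm ≪≫ whiskerRightIso e.counit g ≪≫ λ_ g

theorem cancelRight_whisker {a b c : B} (e : b ≌ c) {f g : a ⟶ b} (θ : f ≅ g) :
    cancelRight e (whiskerRightIso θ e.hom) = θ := by
  ext
  have h : θ.hom ▷ e.hom ▷ e.inv = (α_ _ _ _).hom ≫ θ.hom ▷ (e.hom ≫ e.inv) ≫ (α_ _ _ _).inv := by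
    simp
  simp only [cancelRight, Iso.trans_hom, Iso.symm_hom, whiskerLeftIso_hom, whiskerRightIso_hom, h,
    Iso.inv_hom_id_assoc, Category.assoc]
  rw [← whisker_exchange_assoc]
  simp

theorem cancelLeft_whisker {a b c : B} (e : a ≌ b) {f g : b ⟶ c} (θ : f ≅ g) :
    cancelLeft e (whiskerLeftIso e.hom θ) = θ := by
  ext
  have h : e.inv ◁ e.hom ◁ θ.hom = (α_ _ _ _).inv ≫ (e.inv ≫ e.hom) ◁ θ.hom ≫ (α_ _ _ _).hom := by
    simp
  simp only [cancelLeft, Iso.trans_hom, Iso.symm_hom, whiskerLeftIso_hom, whiskerRightIso_hom, h,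
    Iso.hom_inv_id_assoc, Category.assoc]
  rw [whisker_exchange_assoc]
  simp

theorem whisker_cancelRight {a b c : B} (e : b ≌ c) {f g : a ⟶ b} (θ : f ≫ e.hom ≅ g ≫ e.hom) :
    whiskerRightIso (cancelRight e θ) e.hom = θ := by
  have key : ∀ {x y : a ⟶ c} (p q : x ⟶ y), p ▷ e.inv = q ▷ e.inv → p = q := by
    intro x y p q h
    have h1 : ∀ r : x ⟶ y, r = (ρ_ x).inv ≫ x ◁ e.counit.inv ≫ (α_ _ _ _).inv ≫
        r ▷ e.inv ▷ e.hom ≫ (α_ _ _ _).hom ≫ y ◁ e.counit.hom ≫ (ρ_ y).hom := by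
      intro r
      have h : r ▷ e.inv ▷ e.hom =
          (α_ _ _ _).hom ≫ r ▷ (e.inv ≫ e.hom) ≫ (α_ _ _ _).inv := by simp
      rw [h]
      simp only [Category.assoc, Iso.inv_hom_id_assoc]
      rw [← whisker_exchange_assoc]
      simp
    rw [h1 p, h1 q, h]
  have h := congrArg Iso.hom (cancelRight_whisker e (cancelRight e θ))
  ext
  apply key
  rw [cancelRight] at h
  nth_rewrite 2 [cancelRight] at h
  simp only [Iso.trans_hom, Iso.symm_hom, whiskerLeftIso_hom, whiskerRightIso_hom, cancel_epi] at h
  simp only [← Category.assoc, cancel_mono] at h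
  exact h

theorem whisker_cancelLeft {a b c : B} (e : a ≌ b) {f g : b ⟶ c} (θ : e.hom ≫ f ≅ e.hom ≫ g) :
    whiskerLeftIso e.hom (cancelLeft e θ) = θ := by
  have key : ∀ {x y : a ⟶ c} (p q : x ⟶ y), e.inv ◁ p = e.inv ◁ q → p = q := by
    intro x y p q h
    have h1 : ∀ r : x ⟶ y, r = (λ_ x).inv ≫ e.unit.hom ▷ x ≫ (α_ _ _ _).hom ≫
        e.hom ◁ e.inv ◁ r ≫ (α_ _ _ _).inv ≫ e.unit.inv ▷ y ≫ (λ_ y).hom := by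
      intro r
      have h : e.hom ◁ e.inv ◁ r =
          (α_ _ _ _).inv ≫ (e.hom ≫ e.inv) ◁ r ≫ (α_ _ _ _).hom := by simp
      rw [h]
      simp only [Category.assoc, Iso.hom_inv_id_assoc]
      rw [whisker_exchange_assoc]
      simp
    rw [h1 p, h1 q, h]
  have h := congrArg Iso.hom (cancelLeft_whisker e (cancelLeft e θ))
  ext
  apply key
  rw [cancelLeft] at h
  nth_rewrite 2 [cancelLeft] at h
  simp only [Iso.trans_hom, Iso.symm_hom, whiskerLeftIso_hom, whiskerRightIso_hom, cancel_epi] at h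
  simp only [← Category.assoc, cancel_mono] at h
  exact h

/-- Completing a cube of invertible 2-cells to its missing face, where the edge of the cube that
is to be cancelled is the equivalence `e` at the end: if `t ≫ r` and `l ≫ b` are related by the
connecting 1-cells `a₀, a₁, a₂, e` to `t' ≫ r' ≅ l' ≫ b'`, this is the unique
`t ≫ r ≅ l ≫ b` whose whiskering with `e` is the pasting of the other five faces
(see `whisker_cancelRight`, `cancelRight_whisker`). -/
def fillRight {x y z w x' y' z' w' : B} {t : x ⟶ y} {r : y ⟶ w} {l : x ⟶ z} {b : z ⟶ w}
    {t' : x' ⟶ y'} {r' : y' ⟶ w'} {l' : x' ⟶ z'} {b' : z' ⟶ w'}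
    {a₀ : x ⟶ x'} {a₁ : y ⟶ y'} {a₂ : z ⟶ z'} (e : w ≌ w')
    (st : Sq t a₀ a₁ t') (sr : Sq r a₁ e.hom r') (sl : Sq l a₀ a₂ l') (sb : Sq b a₂ e.hom b')
    (s' : Sq t' l' r' b') : Sq t l r b :=
  cancelRight e
    (α_ t r e.hom ≪≫ whiskerLeftIso t sr ≪≫ (α_ t a₁ r').symm ≪≫ whiskerRightIso st r' ≪≫
      α_ a₀ t' r' ≪≫ whiskerLeftIso a₀ s' ≪≫ (α_ a₀ l' b').symm ≪≫ whiskerRightIso sl.symm b' ≪≫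
      α_ l a₂ b' ≪≫ whiskerLeftIso l sb.symm ≪≫ (α_ l b e.hom).symm)

/-- The same, where the edge to be cancelled is the equivalence `e` at the beginning. -/
def fillLeft {x y z w x' y' z' w' : B} {t : x ⟶ y} {r : y ⟶ w} {l : x ⟶ z} {b : z ⟶ w}
    {t' : x' ⟶ y'} {r' : y' ⟶ w'} {l' : x' ⟶ z'} {b' : z' ⟶ w'}
    (e : x' ≌ x) {a₁ : y' ⟶ y} {a₂ : z' ⟶ z} {a₃ : w' ⟶ w}
    (st : Sq t' e.hom a₁ t) (sr : Sq r' a₁ a₃ r) (sl : Sq l' e.hom a₂ l) (sb : Sq b' a₂ a₃ b)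
    (s' : Sq t' l' r' b') : Sq t l r b :=
  cancelLeft e
    ((α_ e.hom t r).symm ≪≫ whiskerRightIso st.symm r ≪≫ α_ t' a₁ r ≪≫
      whiskerLeftIso t' sr.symm ≪≫ (α_ t' r' a₃).symm ≪≫ whiskerRightIso s' a₃ ≪≫
      α_ l' b' a₃ ≪≫ whiskerLeftIso l' sb ≪≫ (α_ l' a₂ b).symm ≪≫ whiskerRightIso sl b ≪≫
      α_ e.hom l b)

end Generalities

section Premonoidal

open Bicategory

/-- A binoidal structure on a bicategory: an operation `X ⊠ Y` on objects, and pseudofunctors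
`X ⋊ -` and `- ⋉ Y` with `X ⋊ Y = X ⋉ Y = X ⊠ Y` on objects. -/
structure BinoidalStructure (B : Type u) [Bicategory.{w, v} B] where
  tensorObj : B → B → B
  left (X : B) : PseudofunctorOn (B := B) (C := B) (fun Y => tensorObj X Y)
  right (Y : B) : PseudofunctorOn (B := B) (C := B) (fun X => tensorObj X Y)

variable {B : Type u} [Bicategory.{w, v} B]

namespace BinoidalStructure

variable (T : BinoidalStructure B)

/-- The 1-cell `X ⋊ g`. -/
abbrev lw (X : B) {Y Y' : B} (g : Y ⟶ Y') : T.tensorObj X Y ⟶ T.tensorObj X Y' :=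
  (T.left X).map g

/-- The 1-cell `f ⋉ Y`. -/
abbrev rw {X X' : B} (f : X ⟶ X') (Y : B) : T.tensorObj X Y ⟶ T.tensorObj X' Y :=
  (T.right Y).map f

/-- The pseudofunctor `X ⋊ -`. -/
abbrev leftF (X : B) : Pseudofunctor B B := (T.left X).toPseudofunctor

/-- The pseudofunctor `- ⋉ Y`. -/
abbrev rightF (Y : B) : Pseudofunctor B B := (T.right Y).toPseudofunctor

end BinoidalStructure

variable {T : BinoidalStructure B}

local infixr:90 " ⊠ " => BinoidalStructure.tensorObj T
local infixr:85 " ⋊ " => BinoidalStructure.lw T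
local infixl:85 " ⋉ " => BinoidalStructure.rw T

variable (T) in
/-- The 2-cells witnessing that `f` is central. -/
structure CentralityData {X X' : B} (f : X ⟶ X') where
  lc {Y Y' : B} (g : Y ⟶ Y') : Sq (X ⋊ g) (f ⋉ Y) (f ⋉ Y') (X' ⋊ g)
  rc {Y Y' : B} (g : Y ⟶ Y') : Sq (g ⋉ X) (Y ⋊ f) (Y' ⋊ f) (g ⋉ X')

variable (T) in
/-- A central 1-cell: `f` with witnesses making the 1-cells `f ⋉ Y` and `Y ⋊ f` the components
of pseudonatural transformations `X ⋊ - ⟹ X' ⋊ -` and `- ⋉ X ⟹ - ⋉ X'`. -/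
structure Central {X X' : B} (f : X ⟶ X') extends CentralityData T f where
  lc_pseudo : IsPseudonatural (T.leftF X) (T.leftF X') (fun Y => f ⋉ Y) (fun g => lc g)
  rc_pseudo : IsPseudonatural (T.rightF X) (T.rightF X') (fun Y => Y ⋊ f) (fun g => rc g)

/-- A central 2-cell: the 2-cells `σ ⋉ Y` and `Y ⋊ σ` form modifications. -/
def IsCentral₂ {X X' : B} {f f' : X ⟶ X'} (c : CentralityData T f) (c' : CentralityData T f')
    (σ : f ⟶ f') : Prop :=
  (∀ {Y Y' : B} (g : Y ⟶ Y'),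
    Sq.IsModif (c.lc g) (c'.lc g) ((T.right Y).map₂ σ) ((T.right Y').map₂ σ)) ∧
  (∀ {Y Y' : B} (g : Y ⟶ Y'),
    Sq.IsModif (c.rc g) (c'.rc g) ((T.left Y).map₂ σ) ((T.left Y').map₂ σ))

/-- Composition of central 1-cells is composition of the transformations. -/
def CentralityData.comp {X X' X'' : B} {f : X ⟶ X'} {f' : X' ⟶ X''} (c : CentralityData T f)
    (c' : CentralityData T f') : CentralityData T (f ≫ f') where
  lc {Y Y'} g := ((c.lc g).paste (c'.lc g)).conj ((T.right Y).mapComp f f')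
    ((T.right Y').mapComp f f')
  rc {Y Y'} g := ((c.rc g).paste (c'.rc g)).conj ((T.left Y).mapComp f f')
    ((T.left Y').mapComp f f')

variable (T) in
/-- A unit object and the adjoint equivalences `λ`, `ρ`, `α` of a premonoidal bicategory. -/
structure StructuralEquivalences where
  unit : B
  lam (X : B) : (unit ⊠ X) ≌ X
  rho (X : B) : (X ⊠ unit) ≌ X
  assoc (X Y Z : B) : ((X ⊠ Y) ⊠ Z) ≌ (X ⊠ (Y ⊠ Z))

/-- The 1-cell `λ_X : I ⊠ X ⟶ X`. -/
abbrev StructuralEquivalences.l (S : StructuralEquivalences T) (X : B) : S.unit ⊠ X ⟶ X :=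
  (S.lam X).hom

/-- The 1-cell `ρ_X : X ⊠ I ⟶ X`. -/
abbrev StructuralEquivalences.r (S : StructuralEquivalences T) (X : B) : X ⊠ S.unit ⟶ X :=
  (S.rho X).hom

/-- The 1-cell `α_{X,Y,Z} : (X ⊠ Y) ⊠ Z ⟶ X ⊠ (Y ⊠ Z)`. -/
abbrev StructuralEquivalences.a (S : StructuralEquivalences T) (X Y Z : B) :
    (X ⊠ Y) ⊠ Z ⟶ X ⊠ (Y ⊠ Z) :=
  (S.assoc X Y Z).hom

/-- 2-cells making the associator pseudonatural in each argument separately. -/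
structure AssociatorNaturality (S : StructuralEquivalences T) where
  nat₁ {X X' : B} (f : X ⟶ X') (Y Z : B) :
    Sq ((f ⋉ Y) ⋉ Z) (S.a X Y Z) (S.a X' Y Z) (f ⋉ (Y ⊠ Z))
  nat₂ (X : B) {Y Y' : B} (g : Y ⟶ Y') (Z : B) :
    Sq ((X ⋊ g) ⋉ Z) (S.a X Y Z) (S.a X Y' Z) (X ⋊ (g ⋉ Z))
  nat₃ (X Y : B) {Z Z' : B} (h : Z ⟶ Z') :
    Sq ((X ⊠ Y) ⋊ h) (S.a X Y Z) (S.a X Y Z') (X ⋊ (Y ⋊ h))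
  pseudo₁ (Y Z : B) : IsPseudonatural ((T.rightF Y).comp (T.rightF Z)) (T.rightF (Y ⊠ Z))
    (fun X => S.a X Y Z) (fun f => nat₁ f Y Z)
  pseudo₂ (X Z : B) : IsPseudonatural ((T.leftF X).comp (T.rightF Z))
    ((T.rightF Z).comp (T.leftF X)) (fun Y => S.a X Y Z) (fun g => nat₂ X g Z)
  pseudo₃ (X Y : B) : IsPseudonatural (T.leftF (X ⊠ Y)) ((T.leftF Y).comp (T.leftF X))
    (fun Z => S.a X Y Z) (fun h => nat₃ X Y h)

section Lift

variable {S : StructuralEquivalences T} (N : AssociatorNaturality S)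

/-- The action of `X ⋊ -` on central 1-cells: the witnesses are the unique 2-cells compatible
with those of `f` along the associator. -/
def CentralityData.lwhisker (X : B) {A A' : B} {f : A ⟶ A'} (c : CentralityData T f) :
    CentralityData T (X ⋊ f) where
  lc {Y Y'} g := fillRight (S.assoc X A' Y') (N.nat₃ X A g) (N.nat₂ X f Y') (N.nat₂ X f Y)
    (N.nat₃ X A' g) ((c.lc g).map (T.left X))
  rc {Y Y'} g := fillLeft (S.assoc Y X A) (N.nat₁ g X A) (N.nat₃ Y' X f) (N.nat₃ Y X f)
    (N.nat₁ g X A') (c.rc (g ⋉ X))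

/-- The action of `- ⋉ X` on central 1-cells. -/
def CentralityData.rwhisker {A A' : B} {f : A ⟶ A'} (c : CentralityData T f) (X : B) :
    CentralityData T (f ⋉ X) where
  lc {Y Y'} g := fillRight (S.assoc A' X Y') (N.nat₃ A X g) (N.nat₁ f X Y') (N.nat₁ f X Y)
    (N.nat₃ A' X g) (c.lc (X ⋊ g))
  rc {Y Y'} g := fillLeft (S.assoc Y A X) (N.nat₁ g A X) (N.nat₂ Y' f X) (N.nat₂ Y f X)
    (N.nat₁ g A' X) ((c.rc g).map (T.right X))

end Lift

/-- A premonoidal structure on a binoidal bicategory with given unit object and structural adjoint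
equivalences: pseudonaturality and centrality of the latter, and invertible central 2-cells
`p`, `m`, `l`, `r` that are modifications in each argument and satisfy the equations of a
monoidal bicategory. -/
structure PremonoidalStructure (S : StructuralEquivalences T) where
  lamNat {X Y : B} (f : X ⟶ Y) : Sq (S.unit ⋊ f) (S.l X) (S.l Y) f
  lam_pseudo : IsPseudonatural (T.leftF S.unit) (Pseudofunctor.id B) (fun X => S.l X)
    (fun f => lamNat f)
  rhoNat {X Y : B} (f : X ⟶ Y) : Sq (f ⋉ S.unit) (S.r X) (S.r Y) f
  rho_pseudo : IsPseudonatural (T.rightF S.unit) (Pseudofunctor.id B) (fun X => S.r X)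
    (fun f => rhoNat f)
  assocNat : AssociatorNaturality S
  lamCentral (X : B) : Central T (S.l X)
  rhoCentral (X : B) : Central T (S.r X)
  assocCentral (X Y Z : B) : Central T (S.a X Y Z)
  p (X Y Z W : B) : S.a X Y Z ⋉ W ≫ S.a X (Y ⊠ Z) W ≫ X ⋊ S.a Y Z W ≅
    S.a (X ⊠ Y) Z W ≫ S.a X Y (Z ⊠ W)
  m (X Y : B) : S.a X S.unit Y ≫ X ⋊ S.l Y ≅ S.r X ⋉ Y
  l (X Y : B) : S.l X ⋉ Y ≅ S.a S.unit X Y ≫ S.l (X ⊠ Y)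
  r (X Y : B) : S.r (X ⊠ Y) ≅ S.a X Y S.unit ≫ X ⋊ S.r Y
  /- centrality of the structural 2-cells -/
  p_central (X Y Z W : B) : IsCentral₂
    (((assocCentral X Y Z).rwhisker assocNat W).comp
      ((assocCentral X (Y ⊠ Z) W).comp ((assocCentral Y Z W).lwhisker assocNat X)))
    ((assocCentral (X ⊠ Y) Z W).comp (assocCentral X Y (Z ⊠ W)).toCentralityData) (p X Y Z W).hom
  m_central (X Y : B) : IsCentral₂
    ((assocCentral X S.unit Y).comp ((lamCentral Y).lwhisker assocNat X))
    ((rhoCentral X).rwhisker assocNat Y) (m X Y).hom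
  l_central (X Y : B) : IsCentral₂ ((lamCentral X).rwhisker assocNat Y)
    ((assocCentral S.unit X Y).comp (lamCentral (X ⊠ Y)).toCentralityData) (l X Y).hom
  r_central (X Y : B) : IsCentral₂ (rhoCentral (X ⊠ Y)).toCentralityData
    ((assocCentral X Y S.unit).comp ((rhoCentral Y).lwhisker assocNat X)) (r X Y).hom
  /- the structural 2-cells are modifications in each argument -/
  p_modif₁ {X X' : B} (f : X ⟶ X') (Y Z W : B) : Sq.IsModif
    (((assocNat.nat₁ f Y Z).map (T.right W)).paste
      ((assocNat.nat₁ f (Y ⊠ Z) W).paste ((assocCentral Y Z W).rc f)))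
    ((assocNat.nat₁ (f ⋉ Y) Z W).paste (assocNat.nat₁ f Y (Z ⊠ W)))
    (p X Y Z W).hom (p X' Y Z W).hom
  p_modif₂ (X : B) {Y Y' : B} (f : Y ⟶ Y') (Z W : B) : Sq.IsModif
    (((assocNat.nat₂ X f Z).map (T.right W)).paste
      ((assocNat.nat₂ X (f ⋉ Z) W).paste ((assocNat.nat₁ f Z W).map (T.left X))))
    ((assocNat.nat₁ (X ⋊ f) Z W).paste (assocNat.nat₂ X f (Z ⊠ W)))
    (p X Y Z W).hom (p X Y' Z W).hom
  p_modif₃ (X Y : B) {Z Z' : B} (f : Z ⟶ Z') (W : B) : Sq.IsModif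
    (((assocNat.nat₃ X Y f).map (T.right W)).paste
      ((assocNat.nat₂ X (Y ⋊ f) W).paste ((assocNat.nat₂ Y f W).map (T.left X))))
    ((assocNat.nat₂ (X ⊠ Y) f W).paste (assocNat.nat₃ X Y (f ⋉ W)))
    (p X Y Z W).hom (p X Y Z' W).hom
  p_modif₄ (X Y Z : B) {W W' : B} (f : W ⟶ W') : Sq.IsModif
    (((assocCentral X Y Z).lc f).paste
      ((assocNat.nat₃ X (Y ⊠ Z) f).paste ((assocNat.nat₃ Y Z f).map (T.left X))))
    ((assocNat.nat₃ (X ⊠ Y) Z f).paste (assocNat.nat₃ X Y (Z ⋊ f)))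
    (p X Y Z W).hom (p X Y Z W').hom
  m_modif₁ {X X' : B} (f : X ⟶ X') (Y : B) : Sq.IsModif
    ((assocNat.nat₁ f S.unit Y).paste ((lamCentral Y).rc f))
    ((rhoNat f).map (T.right Y)) (m X Y).hom (m X' Y).hom
  m_modif₂ (X : B) {Y Y' : B} (f : Y ⟶ Y') : Sq.IsModif
    ((assocNat.nat₃ X S.unit f).paste ((lamNat f).map (T.left X)))
    ((rhoCentral X).lc f) (m X Y).hom (m X Y').hom
  l_modif₁ {X X' : B} (f : X ⟶ X') (Y : B) : Sq.IsModif
    ((lamNat f).map (T.right Y))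
    ((assocNat.nat₂ S.unit f Y).paste (lamNat (f ⋉ Y))) (l X Y).hom (l X' Y).hom
  l_modif₂ (X : B) {Y Y' : B} (f : Y ⟶ Y') : Sq.IsModif
    ((lamCentral X).lc f)
    ((assocNat.nat₃ S.unit X f).paste (lamNat (X ⋊ f))) (l X Y).hom (l X Y').hom
  r_modif₁ {X X' : B} (f : X ⟶ X') (Y : B) : Sq.IsModif
    (rhoNat (f ⋉ Y))
    ((assocNat.nat₁ f Y S.unit).paste ((rhoCentral Y).rc f)) (r X Y).hom (r X' Y).hom
  r_modif₂ (X : B) {Y Y' : B} (f : Y ⟶ Y') : Sq.IsModif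
    (rhoNat (X ⋊ f))
    ((assocNat.nat₂ X f S.unit).paste ((rhoNat f).map (T.left X))) (r X Y).hom (r X Y').hom
  /- the associahedron equation -/
  associahedron (V X Y Z W : B) :
    Iso.refl ((S.a V X Y ⋉ Z) ⋉ W ≫ S.a V (X ⊠ Y) Z ⋉ W ≫ (V ⋊ S.a X Y Z) ⋉ W ≫
        S.a V (X ⊠ Y ⊠ Z) W ≫ V ⋊ S.a X (Y ⊠ Z) W ≫ V ⋊ (X ⋊ S.a Y Z W)) ≪⊗≫
      whiskerRightIso ((T.right W).map₃₂ (p V X Y Z))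
        (S.a V (X ⊠ Y ⊠ Z) W ≫ V ⋊ S.a X (Y ⊠ Z) W ≫ V ⋊ (X ⋊ S.a Y Z W)) ≪⊗≫
      whiskerLeftIso (S.a (V ⊠ X) Y Z ⋉ W)
        (whiskerRightIso (p V X (Y ⊠ Z) W) (V ⋊ (X ⋊ S.a Y Z W))) ≪⊗≫
      whiskerLeftIso (S.a (V ⊠ X) Y Z ⋉ W ≫ S.a (V ⊠ X) (Y ⊠ Z) W)
        (assocNat.nat₃ V X (S.a Y Z W)).symm ≪⊗≫
      whiskerRightIso (p (V ⊠ X) Y Z W) (S.a V X (Y ⊠ Z ⊠ W)) ≪⊗≫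
      Iso.refl (S.a ((V ⊠ X) ⊠ Y) Z W ≫ S.a (V ⊠ X) Y (Z ⊠ W) ≫ S.a V X (Y ⊠ Z ⊠ W)) =
    Iso.refl ((S.a V X Y ⋉ Z) ⋉ W ≫ S.a V (X ⊠ Y) Z ⋉ W ≫ (V ⋊ S.a X Y Z) ⋉ W ≫
        S.a V (X ⊠ Y ⊠ Z) W ≫ V ⋊ S.a X (Y ⊠ Z) W ≫ V ⋊ (X ⋊ S.a Y Z W)) ≪⊗≫
      whiskerLeftIso ((S.a V X Y ⋉ Z) ⋉ W ≫ S.a V (X ⊠ Y) Z ⋉ W)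
        (whiskerRightIso (assocNat.nat₂ V (S.a X Y Z) W)
          (V ⋊ S.a X (Y ⊠ Z) W ≫ V ⋊ (X ⋊ S.a Y Z W))) ≪⊗≫
      whiskerLeftIso
        ((S.a V X Y ⋉ Z) ⋉ W ≫ S.a V (X ⊠ Y) Z ⋉ W ≫ S.a V ((X ⊠ Y) ⊠ Z) W)
        ((T.left V).map₃₂ (p X Y Z W)) ≪⊗≫
      whiskerLeftIso ((S.a V X Y ⋉ Z) ⋉ W)
        (whiskerRightIso (p V (X ⊠ Y) Z W) (V ⋊ S.a X Y (Z ⊠ W))) ≪⊗≫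
      whiskerRightIso (assocNat.nat₁ (S.a V X Y) Z W)
        (S.a V (X ⊠ Y) (Z ⊠ W) ≫ V ⋊ S.a X Y (Z ⊠ W)) ≪⊗≫
      whiskerLeftIso (S.a ((V ⊠ X) ⊠ Y) Z W) (p V X Y (Z ⊠ W)) ≪⊗≫
      Iso.refl (S.a ((V ⊠ X) ⊠ Y) Z W ≫ S.a (V ⊠ X) Y (Z ⊠ W) ≫ S.a V X (Y ⊠ Z ⊠ W))
  /- the equations relating `p` with the unitors, for the unit object in each of the four places -/
  unit₁ (X Y Z : B) :
    Iso.refl (S.a S.unit X Y ⋉ Z ≫ S.a S.unit (X ⊠ Y) Z ≫ S.unit ⋊ S.a X Y Z ≫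
        S.l (X ⊠ Y ⊠ Z)) ≪⊗≫
      whiskerRightIso (p S.unit X Y Z) (S.l (X ⊠ Y ⊠ Z)) ≪⊗≫
      whiskerLeftIso (S.a (S.unit ⊠ X) Y Z) (l X (Y ⊠ Z)).symm ≪⊗≫
      Iso.refl (S.a (S.unit ⊠ X) Y Z ≫ S.l X ⋉ (Y ⊠ Z)) =
    Iso.refl (S.a S.unit X Y ⋉ Z ≫ S.a S.unit (X ⊠ Y) Z ≫ S.unit ⋊ S.a X Y Z ≫
        S.l (X ⊠ Y ⊠ Z)) ≪⊗≫
      whiskerLeftIso (S.a S.unit X Y ⋉ Z ≫ S.a S.unit (X ⊠ Y) Z) (lamNat (S.a X Y Z)) ≪⊗≫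
      whiskerLeftIso (S.a S.unit X Y ⋉ Z) (whiskerRightIso (l (X ⊠ Y) Z).symm (S.a X Y Z)) ≪⊗≫
      whiskerRightIso ((T.right Z).map₂₁ (l X Y).symm) (S.a X Y Z) ≪⊗≫
      assocNat.nat₁ (S.l X) Y Z ≪⊗≫
      Iso.refl (S.a (S.unit ⊠ X) Y Z ≫ S.l X ⋉ (Y ⊠ Z))
  unit₂ (X Y Z : B) :
    Iso.refl (S.a X S.unit Y ⋉ Z ≫ S.a X (S.unit ⊠ Y) Z ≫ X ⋊ S.a S.unit Y Z ≫
        X ⋊ S.l (Y ⊠ Z)) ≪⊗≫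
      whiskerRightIso (p X S.unit Y Z) (X ⋊ S.l (Y ⊠ Z)) ≪⊗≫
      whiskerLeftIso (S.a (X ⊠ S.unit) Y Z) (m X (Y ⊠ Z)) ≪⊗≫
      Iso.refl (S.a (X ⊠ S.unit) Y Z ≫ S.r X ⋉ (Y ⊠ Z)) =
    Iso.refl (S.a X S.unit Y ⋉ Z ≫ S.a X (S.unit ⊠ Y) Z ≫ X ⋊ S.a S.unit Y Z ≫
        X ⋊ S.l (Y ⊠ Z)) ≪⊗≫
      whiskerLeftIso (S.a X S.unit Y ⋉ Z ≫ S.a X (S.unit ⊠ Y) Z)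
        ((T.left X).map₂₁ (l Y Z).symm) ≪⊗≫
      whiskerLeftIso (S.a X S.unit Y ⋉ Z) (assocNat.nat₂ X (S.l Y) Z).symm ≪⊗≫
      whiskerRightIso ((T.right Z).map₂₁ (m X Y)) (S.a X Y Z) ≪⊗≫
      assocNat.nat₁ (S.r X) Y Z ≪⊗≫
      Iso.refl (S.a (X ⊠ S.unit) Y Z ≫ S.r X ⋉ (Y ⊠ Z))
  unit₃ (X Y Z : B) :
    Iso.refl (S.a X Y S.unit ⋉ Z ≫ S.a X (Y ⊠ S.unit) Z ≫ X ⋊ S.a Y S.unit Z ≫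
        X ⋊ (Y ⋊ S.l Z)) ≪⊗≫
      whiskerRightIso (p X Y S.unit Z) (X ⋊ (Y ⋊ S.l Z)) ≪⊗≫
      whiskerLeftIso (S.a (X ⊠ Y) S.unit Z) (assocNat.nat₃ X Y (S.l Z)).symm ≪⊗≫
      whiskerRightIso (m (X ⊠ Y) Z) (S.a X Y Z) ≪⊗≫
      Iso.refl (S.r (X ⊠ Y) ⋉ Z ≫ S.a X Y Z) =
    Iso.refl (S.a X Y S.unit ⋉ Z ≫ S.a X (Y ⊠ S.unit) Z ≫ X ⋊ S.a Y S.unit Z ≫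
        X ⋊ (Y ⋊ S.l Z)) ≪⊗≫
      whiskerLeftIso (S.a X Y S.unit ⋉ Z ≫ S.a X (Y ⊠ S.unit) Z)
        ((T.left X).map₂₁ (m Y Z)) ≪⊗≫
      whiskerLeftIso (S.a X Y S.unit ⋉ Z) (assocNat.nat₂ X (S.r Y) Z).symm ≪⊗≫
      whiskerRightIso ((T.right Z).map₂₁ (r X Y).symm) (S.a X Y Z) ≪⊗≫
      Iso.refl (S.r (X ⊠ Y) ⋉ Z ≫ S.a X Y Z)
  unit₄ (X Y Z : B) :
    Iso.refl (S.a X Y Z ⋉ S.unit ≫ S.a X (Y ⊠ Z) S.unit ≫ X ⋊ S.a Y Z S.unit ≫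
        X ⋊ (Y ⋊ S.r Z)) ≪⊗≫
      whiskerRightIso (p X Y Z S.unit) (X ⋊ (Y ⋊ S.r Z)) ≪⊗≫
      whiskerLeftIso (S.a (X ⊠ Y) Z S.unit) (assocNat.nat₃ X Y (S.r Z)).symm ≪⊗≫
      whiskerRightIso (r (X ⊠ Y) Z).symm (S.a X Y Z) ≪⊗≫
      Iso.refl (S.r ((X ⊠ Y) ⊠ Z) ≫ S.a X Y Z) =
    Iso.refl (S.a X Y Z ⋉ S.unit ≫ S.a X (Y ⊠ Z) S.unit ≫ X ⋊ S.a Y Z S.unit ≫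
        X ⋊ (Y ⋊ S.r Z)) ≪⊗≫
      whiskerLeftIso (S.a X Y Z ⋉ S.unit ≫ S.a X (Y ⊠ Z) S.unit)
        ((T.left X).map₂₁ (r Y Z).symm) ≪⊗≫
      whiskerLeftIso (S.a X Y Z ⋉ S.unit) (r X (Y ⊠ Z)).symm ≪⊗≫
      rhoNat (S.a X Y Z) ≪⊗≫
      Iso.refl (S.r ((X ⊠ Y) ⊠ Z) ≫ S.a X Y Z)

end Premonoidal

section Kleisli

open MonoidalCategory

attribute [local instance] endofunctorMonoidalCategory

/-- A compatible pair of a left strength `t` and a right strength `s` on an endofunctor. -/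
structure Bistrength {C : Type u₂} [Category.{v₂} C] [MonoidalCategory C] (F : C ⥤ C) where
  t (A B : C) : A ⊗ F.obj B ⟶ F.obj (A ⊗ B)
  s (A B : C) : F.obj A ⊗ B ⟶ F.obj (A ⊗ B)
  t_natural {A A' B B' : C} (f : A ⟶ A') (g : B ⟶ B') :
    (f ⊗ₘ F.map g) ≫ t A' B' = t A B ≫ F.map (f ⊗ₘ g)
  s_natural {A A' B B' : C} (f : A ⟶ A') (g : B ⟶ B') :
    (F.map f ⊗ₘ g) ≫ s A' B' = s A B ≫ F.map (f ⊗ₘ g)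
  t_unit (A : C) : t (𝟙_ C) A ≫ F.map (λ_ A).hom = (λ_ (F.obj A)).hom
  s_unit (A : C) : s A (𝟙_ C) ≫ F.map (ρ_ A).hom = (ρ_ (F.obj A)).hom
  t_assoc (A B D : C) : t (A ⊗ B) D ≫ F.map (α_ A B D).hom =
    (α_ A B (F.obj D)).hom ≫ A ◁ t B D ≫ t A (B ⊗ D)
  s_assoc (A B D : C) : s A B ▷ D ≫ s (A ⊗ B) D ≫ F.map (α_ A B D).hom =
    (α_ (F.obj A) B D).hom ≫ s A (B ⊗ D)
  compat (A B D : C) : t A B ▷ D ≫ s (A ⊗ B) D ≫ F.map (α_ A B D).hom =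
    (α_ A (F.obj B) D).hom ≫ A ◁ s B D ≫ t A (B ⊗ D)

/-- A bistrong graded monad on `C` with grades `E`: a lax monoidal functor `T` from `E` to the
endofunctors of `C` (where `F ⊗ G` is `F` followed by `G`), with a bistrength on each `T e`, such
that the natural transformations `T γ`, `η : 𝟭 ⟶ T I`, `μ e e' : T e' ∘ T e ⟶ T (e ⊗ e')` commute
with both strengths. -/
structure BistrongGradedMonad (E : Type u₁) [Category.{v₁} E] [MonoidalCategory E]
    (C : Type u₂) [Category.{v₂} C] [MonoidalCategory C] where
  T : E ⥤ C ⥤ C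
  [lax : T.LaxMonoidal]
  str (e : E) : Bistrength (T.obj e)
  map_t {e e' : E} (γ : e ⟶ e') (A B : C) :
    A ◁ (T.map γ).app B ≫ (str e').t A B = (str e).t A B ≫ (T.map γ).app (A ⊗ B)
  map_s {e e' : E} (γ : e ⟶ e') (A B : C) :
    (T.map γ).app A ▷ B ≫ (str e').s A B = (str e).s A B ≫ (T.map γ).app (A ⊗ B)
  η_t (A B : C) : A ◁ (Functor.LaxMonoidal.ε T).app B ≫ (str (𝟙_ E)).t A B =
    (Functor.LaxMonoidal.ε T).app (A ⊗ B)
  η_s (A B : C) : (Functor.LaxMonoidal.ε T).app A ▷ B ≫ (str (𝟙_ E)).s A B =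
    (Functor.LaxMonoidal.ε T).app (A ⊗ B)
  μ_t (e e' : E) (A B : C) :
    A ◁ (Functor.LaxMonoidal.μ T e e').app B ≫ (str (e ⊗ e')).t A B =
      (str e').t A ((T.obj e).obj B) ≫ (T.obj e').map ((str e).t A B) ≫
        (Functor.LaxMonoidal.μ T e e').app (A ⊗ B)
  μ_s (e e' : E) (A B : C) :
    (Functor.LaxMonoidal.μ T e e').app A ▷ B ≫ (str (e ⊗ e')).s A B =
      (str e').s ((T.obj e).obj A) B ≫ (T.obj e').map ((str e).s A B) ≫
        (Functor.LaxMonoidal.μ T e e').app (A ⊗ B)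

variable {E : Type u₁} [Category.{v₁} E] [MonoidalCategory E]
  {C : Type u₂} [Category.{v₂} C] [MonoidalCategory C]

namespace BistrongGradedMonad

variable (M : BistrongGradedMonad E C)

/-- The functor `T_e`. -/
abbrev F (e : E) : C ⥤ C := M.T.obj e

/-- The regrading `T_e A ⟶ T_e' A`. -/
abbrev reg {e e' : E} (γ : e ⟶ e') (A : C) : (M.F e).obj A ⟶ (M.F e').obj A := (M.T.map γ).app A

@[simp]
theorem reg_id (e : E) (A : C) : M.reg (𝟙 e) A = 𝟙 _ := by simp [reg]

theorem reg_comp {e₁ e₂ e₃ : E} (γ : e₁ ⟶ e₂) (δ : e₂ ⟶ e₃) (A : C) :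
    M.reg (γ ≫ δ) A = M.reg γ A ≫ M.reg δ A := by simp [reg]

theorem reg_natural {e e' : E} (γ : e ⟶ e') {A B : C} (f : A ⟶ B) :
    (M.F e).map f ≫ M.reg γ B = M.reg γ A ≫ (M.F e').map f := (M.T.map γ).naturality f

theorem reg_t {e e' : E} (γ : e ⟶ e') (A B : C) :
    A ◁ M.reg γ B ≫ (M.str e').t A B = (M.str e).t A B ≫ M.reg γ (A ⊗ B) := M.map_t γ A B

theorem reg_s {e e' : E} (γ : e ⟶ e') (A B : C) :
    M.reg γ A ▷ B ≫ (M.str e').s A B = (M.str e).s A B ≫ M.reg γ (A ⊗ B) := M.map_s γ A B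

/-- The unit of the graded monad. -/
def η (A : C) : A ⟶ (M.F (𝟙_ E)).obj A :=
  letI := M.lax
  (Functor.LaxMonoidal.ε M.T).app A

/-- The multiplication of the graded monad. -/
def μ (e e' : E) (A : C) : (M.F e').obj ((M.F e).obj A) ⟶ (M.F (e ⊗ e')).obj A :=
  letI := M.lax
  (Functor.LaxMonoidal.μ M.T e e').app A

theorem η_natural {A B : C} (f : A ⟶ B) : f ≫ M.η B = M.η A ≫ (M.F (𝟙_ E)).map f :=
  letI := M.lax
  (Functor.LaxMonoidal.ε M.T).naturality f

theorem μ_natural (e e' : E) {A B : C} (f : A ⟶ B) :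
    (M.F e').map ((M.F e).map f) ≫ M.μ e e' B = M.μ e e' A ≫ (M.F (e ⊗ e')).map f :=
  letI := M.lax
  (Functor.LaxMonoidal.μ M.T e e').naturality f

theorem μ_reg_left {e₁ e₂ : E} (γ : e₁ ⟶ e₂) (e' : E) (A : C) :
    (M.F e').map (M.reg γ A) ≫ M.μ e₂ e' A = M.μ e₁ e' A ≫ M.reg (γ ▷ e') A :=
  letI := M.lax
  congrArg (fun x => NatTrans.app x A) (Functor.LaxMonoidal.μ_natural_left (F := M.T) γ e')

theorem μ_reg_right (e' : E) {e₁ e₂ : E} (γ : e₁ ⟶ e₂) (A : C) :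
    M.reg γ ((M.F e').obj A) ≫ M.μ e' e₂ A = M.μ e' e₁ A ≫ M.reg (e' ◁ γ) A :=
  letI := M.lax
  congrArg (fun x => NatTrans.app x A) (Functor.LaxMonoidal.μ_natural_right (F := M.T) e' γ)

theorem μ_assoc (e e' e'' : E) (A : C) :
    (M.F e'').map (M.μ e e' A) ≫ M.μ (e ⊗ e') e'' A ≫ M.reg (α_ e e' e'').hom A =
      M.μ e' e'' ((M.F e).obj A) ≫ M.μ e (e' ⊗ e'') A := by
  let := M.lax
  have h := congrArg (fun x => NatTrans.app x A)
    (Functor.LaxMonoidal.associativity (F := M.T) e e' e'')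
  exact h.trans (Category.id_comp _)

theorem μ_unit_left (e : E) (A : C) :
    (M.F e).map (M.η A) ≫ M.μ (𝟙_ E) e A ≫ M.reg (λ_ e).hom A = 𝟙 _ := by
  let := M.lax
  have h := congrArg (fun x => NatTrans.app x A)
    (Functor.LaxMonoidal.left_unitality (F := M.T) e)
  exact h.symm

theorem μ_unit_right (e : E) (A : C) :
    M.η ((M.F e).obj A) ≫ M.μ e (𝟙_ E) A ≫ M.reg (ρ_ e).hom A = 𝟙 _ := by
  let := M.lax
  have h := congrArg (fun x => NatTrans.app x A)
    (Functor.LaxMonoidal.right_unitality (F := M.T) e)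
  exact h.symm

theorem t_η (A B : C) : A ◁ M.η B ≫ (M.str (𝟙_ E)).t A B = M.η (A ⊗ B) := M.η_t A B

theorem s_η (A B : C) : M.η A ▷ B ≫ (M.str (𝟙_ E)).s A B = M.η (A ⊗ B) := M.η_s A B

theorem t_μ (e e' : E) (A B : C) : A ◁ M.μ e e' B ≫ (M.str (e ⊗ e')).t A B =
    (M.str e').t A ((M.F e).obj B) ≫ (M.F e').map ((M.str e).t A B) ≫ M.μ e e' (A ⊗ B) :=
  M.μ_t e e' A B

theorem s_μ (e e' : E) (A B : C) : M.μ e e' A ▷ B ≫ (M.str (e ⊗ e')).s A B =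
    (M.str e').s ((M.F e).obj A) B ≫ (M.F e').map ((M.str e).s A B) ≫ M.μ e e' (A ⊗ B) :=
  M.μ_s e e' A B

end BistrongGradedMonad

/-- The objects of the Kleisli bicategory: those of `C`. -/
structure Kleisli (M : BistrongGradedMonad E C) where
  of : C

namespace Kleisli

variable {M : BistrongGradedMonad E C}

/-- A 1-cell `A ⟶ B`: a grade `e` and a morphism `A ⟶ T_e B`. -/
structure Hom (A B : Kleisli M) where
  grade : E
  hom : A.of ⟶ (M.F grade).obj B.of

/-- A 2-cell `(e, f) ⟶ (e', f')`: a morphism `e ⟶ e'` that regrades `f` to `f'`. -/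
@[ext]
structure Hom₂ {A B : Kleisli M} (f g : Hom A B) where
  grade : f.grade ⟶ g.grade
  w : f.hom ≫ M.reg grade B.of = g.hom

/-- The identity 1-cell is the unit; composition uses the multiplication. -/
instance : CategoryStruct (Kleisli M) where
  Hom := Hom
  id A := ⟨𝟙_ E, M.η A.of⟩
  comp {_ _ D} f g :=
    ⟨g.grade ⊗ f.grade, f.hom ≫ (M.F f.grade).map g.hom ≫ M.μ g.grade f.grade D.of⟩

instance homCategory (A B : Kleisli M) : Category (A ⟶ B) where
  Hom f g := Hom₂ f g
  id f := ⟨𝟙 (Hom.grade f), by simp⟩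
  comp σ τ := ⟨Hom₂.grade σ ≫ Hom₂.grade τ, by rw [M.reg_comp, ← τ.w, ← σ.w, Category.assoc]⟩
  id_comp _ := Hom₂.ext (Category.id_comp _)
  comp_id _ := Hom₂.ext (Category.comp_id _)
  assoc _ _ _ := Hom₂.ext (Category.assoc _ _ _)

@[simp] theorem id_grade (A : Kleisli M) : Hom.grade (𝟙 A) = 𝟙_ E := rfl
@[simp] theorem id_hom (A : Kleisli M) : Hom.hom (𝟙 A) = M.η A.of := rfl
@[simp] theorem comp_grade {A B D : Kleisli M} (f : A ⟶ B) (g : B ⟶ D) :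
    Hom.grade (f ≫ g) = Hom.grade g ⊗ Hom.grade f := rfl
@[simp] theorem comp_hom {A B D : Kleisli M} (f : A ⟶ B) (g : B ⟶ D) :
    Hom.hom (f ≫ g) = f.hom ≫ (M.F f.grade).map g.hom ≫ M.μ g.grade f.grade D.of := rfl
@[simp] theorem id₂_grade {A B : Kleisli M} (f : A ⟶ B) : Hom₂.grade (𝟙 f) = 𝟙 f.grade := rfl
@[simp] theorem comp₂_grade {A B : Kleisli M} {f g h : A ⟶ B} (σ : f ⟶ g) (τ : g ⟶ h) :
    Hom₂.grade (σ ≫ τ) = Hom₂.grade σ ≫ Hom₂.grade τ := rfl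

theorem hom₂_ext {A B : Kleisli M} {f g : A ⟶ B} {σ τ : f ⟶ g}
    (h : Hom₂.grade σ = Hom₂.grade τ) : σ = τ := Hom₂.ext h

/-- An invertible 2-cell from an isomorphism of grades. -/
def mkIso {A B : Kleisli M} {f g : A ⟶ B} (i : f.grade ≅ g.grade)
    (w : f.hom ≫ M.reg i.hom B.of = g.hom) : f ≅ g where
  hom := ⟨i.hom, w⟩
  inv := ⟨i.inv, by rw [← w, Category.assoc, ← M.reg_comp, i.hom_inv_id, M.reg_id, Category.comp_id]⟩
  hom_inv_id := hom₂_ext i.hom_inv_id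
  inv_hom_id := hom₂_ext i.inv_hom_id

@[simp] theorem mkIso_hom_grade {A B : Kleisli M} {f g : A ⟶ B} (i : f.grade ≅ g.grade)
    (w : f.hom ≫ M.reg i.hom B.of = g.hom) : Hom₂.grade (mkIso i w).hom = i.hom := rfl
@[simp] theorem mkIso_inv_grade {A B : Kleisli M} {f g : A ⟶ B} (i : f.grade ≅ g.grade)
    (w : f.hom ≫ M.reg i.hom B.of = g.hom) : Hom₂.grade (mkIso i w).inv = i.inv := rfl

/-- Left whiskering. -/
def wl {A B D : Kleisli M} (f : A ⟶ B) {g h : B ⟶ D} (σ : g ⟶ h) : f ≫ g ⟶ f ≫ h :=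
  Hom₂.mk (Hom₂.grade σ ▷ Hom.grade f) (by
    dsimp only [comp_hom, comp_grade]
    rw [← Hom₂.w σ, Functor.map_comp]
    simp only [Category.assoc, M.μ_reg_left])

/-- Right whiskering. -/
def wr {A B D : Kleisli M} {f g : A ⟶ B} (σ : f ⟶ g) (h : B ⟶ D) : f ≫ h ⟶ g ≫ h :=
  Hom₂.mk (Hom.grade h ◁ Hom₂.grade σ) (by
    dsimp only [comp_hom, comp_grade]
    rw [← Hom₂.w σ]
    simp only [Category.assoc, ← M.μ_reg_right, ← reassoc_of% M.reg_natural])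

@[simp] theorem wl_grade {A B D : Kleisli M} (f : A ⟶ B) {g h : B ⟶ D} (σ : g ⟶ h) :
    Hom₂.grade (wl f σ) = Hom₂.grade σ ▷ Hom.grade f := rfl
@[simp] theorem wr_grade {A B D : Kleisli M} {f g : A ⟶ B} (σ : f ⟶ g) (h : B ⟶ D) :
    Hom₂.grade (wr σ h) = Hom.grade h ◁ Hom₂.grade σ := rfl

/-- The associator. -/
def assocIso {A B D K : Kleisli M} (f : A ⟶ B) (g : B ⟶ D) (h : D ⟶ K) :
    (f ≫ g) ≫ h ≅ f ≫ g ≫ h :=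
  mkIso (α_ (Hom.grade h) (Hom.grade g) (Hom.grade f)).symm (by
    dsimp only [comp_hom, comp_grade, Iso.symm_hom]
    simp only [Category.assoc, Functor.map_comp, ← reassoc_of% M.μ_natural]
    rw [← cancel_mono (M.reg (α_ (Hom.grade h) (Hom.grade g) (Hom.grade f)).hom _)]
    simp only [Category.assoc, ← M.reg_comp, Iso.inv_hom_id, M.reg_id, Category.comp_id]
    rw [M.μ_assoc])

/-- The left unitor. -/
def leftUnitorIso {A B : Kleisli M} (f : A ⟶ B) : 𝟙 A ≫ f ≅ f :=
  mkIso (ρ_ (Hom.grade f)) (by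
    dsimp only [comp_hom, comp_grade, id_hom, id_grade]
    simp only [Category.assoc, ← reassoc_of% M.η_natural, M.μ_unit_right, Category.comp_id])

/-- The right unitor. -/
def rightUnitorIso {A B : Kleisli M} (f : A ⟶ B) : f ≫ 𝟙 B ≅ f :=
  mkIso (λ_ (Hom.grade f)) (by
    dsimp only [comp_hom, comp_grade, id_hom, id_grade]
    simp only [Category.assoc, M.μ_unit_left, Category.comp_id])

/-- The Kleisli bicategory of a graded monad. -/
instance : Bicategory (Kleisli M) where
  homCategory := homCategory
  whiskerLeft f _ _ σ := wl f σ
  whiskerRight σ h := wr σ h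
  associator := assocIso
  leftUnitor := leftUnitorIso
  rightUnitor := rightUnitorIso
  whiskerLeft_id _ _ := hom₂_ext (by simp)
  whiskerLeft_comp _ _ _ _ _ _ := hom₂_ext (by simp)
  id_whiskerLeft _ := hom₂_ext (by simp [leftUnitorIso])
  comp_whiskerLeft _ _ _ _ _ := hom₂_ext (by simp [assocIso])
  id_whiskerRight _ _ := hom₂_ext (by simp)
  comp_whiskerRight _ _ _ := hom₂_ext (by simp)
  whiskerRight_id _ := hom₂_ext (by simp [rightUnitorIso])
  whiskerRight_comp _ _ _ := hom₂_ext (by simp [assocIso])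
  whisker_assoc _ _ _ _ _ := hom₂_ext (by simp [assocIso])
  whisker_exchange _ _ := hom₂_ext (by simp [whisker_exchange])
  pentagon _ _ _ _ := hom₂_ext (by simp [assocIso])
  triangle _ _ := hom₂_ext (by simp [assocIso, leftUnitorIso, rightUnitorIso])

@[simp] theorem whiskerLeft_grade {A B D : Kleisli M} (f : A ⟶ B) {g h : B ⟶ D} (σ : g ⟶ h) :
    Hom₂.grade (Bicategory.whiskerLeft f σ) = Hom₂.grade σ ▷ Hom.grade f := rfl
@[simp] theorem whiskerRight_grade {A B D : Kleisli M} {f g : A ⟶ B} (σ : f ⟶ g) (h : B ⟶ D) :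
    Hom₂.grade (Bicategory.whiskerRight σ h) = Hom.grade h ◁ Hom₂.grade σ := rfl
@[simp] theorem associator_hom_grade {A B D K : Kleisli M} (f : A ⟶ B) (g : B ⟶ D) (h : D ⟶ K) :
    Hom₂.grade (Bicategory.associator f g h).hom =
      (α_ (Hom.grade h) (Hom.grade g) (Hom.grade f)).inv := rfl
@[simp] theorem associator_inv_grade {A B D K : Kleisli M} (f : A ⟶ B) (g : B ⟶ D) (h : D ⟶ K) :
    Hom₂.grade (Bicategory.associator f g h).inv =
      (α_ (Hom.grade h) (Hom.grade g) (Hom.grade f)).hom := rfl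
@[simp] theorem leftUnitor_hom_grade {A B : Kleisli M} (f : A ⟶ B) :
    Hom₂.grade (Bicategory.leftUnitor f).hom = (ρ_ (Hom.grade f)).hom := rfl
@[simp] theorem leftUnitor_inv_grade {A B : Kleisli M} (f : A ⟶ B) :
    Hom₂.grade (Bicategory.leftUnitor f).inv = (ρ_ (Hom.grade f)).inv := rfl
@[simp] theorem rightUnitor_hom_grade {A B : Kleisli M} (f : A ⟶ B) :
    Hom₂.grade (Bicategory.rightUnitor f).hom = (λ_ (Hom.grade f)).hom := rfl
@[simp] theorem rightUnitor_inv_grade {A B : Kleisli M} (f : A ⟶ B) :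
    Hom₂.grade (Bicategory.rightUnitor f).inv = (λ_ (Hom.grade f)).inv := rfl

/-- The strict pseudofunctor `X ⋊ -` induced by the left strength. -/
def leftFunctor (X : Kleisli M) :
    PseudofunctorOn (B := Kleisli M) (C := Kleisli M) (fun Y => ⟨X.of ⊗ Y.of⟩) where
  map {Y Y'} g := Hom.mk (Hom.grade g) (X.of ◁ Hom.hom g ≫ (M.str (Hom.grade g)).t X.of Y'.of)
  map₂ {Y Y' g g'} σ := Hom₂.mk (Hom₂.grade (f := g) (g := g') σ) (by
    dsimp only
    rw [← Hom₂.w (f := g) (g := g') σ]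
    simp only [Category.assoc, MonoidalCategory.whiskerLeft_comp, M.reg_t])
  mapId Y := mkIso (Iso.refl (𝟙_ E)) (by
    dsimp only [id_hom, id_grade, Iso.refl_hom]
    rw [M.reg_id, Category.comp_id, M.t_η])
  mapComp {Y Y' Y''} g g' := mkIso (Iso.refl (Hom.grade g' ⊗ Hom.grade g)) (by
    dsimp only [comp_hom, comp_grade, Iso.refl_hom]
    rw [M.reg_id, Category.comp_id]
    have h := (M.str (Hom.grade g)).t_natural (𝟙 X.of) (Hom.hom g')
    simp only [MonoidalCategory.id_tensorHom] at h
    simp only [Category.assoc, MonoidalCategory.whiskerLeft_comp, M.t_μ, reassoc_of% h,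
      Functor.map_comp])
  map₂_id _ := rfl
  map₂_comp _ _ := rfl
  map₂_whisker_left _ _ _ _ := hom₂_ext (by simp)
  map₂_whisker_right _ _ := hom₂_ext (by simp)
  map₂_associator _ _ _ := hom₂_ext (by simp)
  map₂_left_unitor _ := hom₂_ext (by simp)
  map₂_right_unitor _ := hom₂_ext (by simp)

/-- The strict pseudofunctor `- ⋉ Y` induced by the right strength. -/
def rightFunctor (Y : Kleisli M) :
    PseudofunctorOn (B := Kleisli M) (C := Kleisli M) (fun X => ⟨X.of ⊗ Y.of⟩) where
  map {X X'} f := Hom.mk (Hom.grade f) (Hom.hom f ▷ Y.of ≫ (M.str (Hom.grade f)).s X'.of Y.of)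
  map₂ {X X' f f'} σ := Hom₂.mk (Hom₂.grade (f := f) (g := f') σ) (by
    dsimp only
    rw [← Hom₂.w (f := f) (g := f') σ]
    simp only [Category.assoc, MonoidalCategory.comp_whiskerRight, M.reg_s])
  mapId X := mkIso (Iso.refl (𝟙_ E)) (by
    dsimp only [id_hom, id_grade, Iso.refl_hom]
    rw [M.reg_id, Category.comp_id, M.s_η])
  mapComp {X X' X''} f f' := mkIso (Iso.refl (Hom.grade f' ⊗ Hom.grade f)) (by
    dsimp only [comp_hom, comp_grade, Iso.refl_hom]
    rw [M.reg_id, Category.comp_id]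
    have h := (M.str (Hom.grade f)).s_natural (Hom.hom f') (𝟙 Y.of)
    simp only [MonoidalCategory.tensorHom_id] at h
    simp only [Category.assoc, MonoidalCategory.comp_whiskerRight, M.s_μ, reassoc_of% h,
      Functor.map_comp])
  map₂_id _ := rfl
  map₂_comp _ _ := rfl
  map₂_whisker_left _ _ _ _ := hom₂_ext (by simp)
  map₂_whisker_right _ _ := hom₂_ext (by simp)
  map₂_associator _ _ _ := hom₂_ext (by simp)
  map₂_left_unitor _ := hom₂_ext (by simp)
  map₂_right_unitor _ := hom₂_ext (by simp)

variable (M) in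
/-- The binoidal structure of the Kleisli bicategory:
`X ⋊ g = (X ⊗ g) ≫ t` and `f ⋉ Y = (f ⊗ Y) ≫ s`. -/
def binoidal : BinoidalStructure (Kleisli M) where
  tensorObj X Y := ⟨X.of ⊗ Y.of⟩
  left := leftFunctor
  right := rightFunctor

/-- The pure 1-cell determined by a morphism of `C`. -/
def pure {A B : Kleisli M} (f : A.of ⟶ B.of) : A ⟶ B := Hom.mk (𝟙_ E) (f ≫ M.η B.of)

theorem pure_comp_pure {A B D : Kleisli M} (f : A.of ⟶ B.of) (g : B.of ⟶ D.of) :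
    Hom.hom (pure f ≫ pure g) ≫ M.reg (λ_ (𝟙_ E)).hom D.of = f ≫ g ≫ M.η D.of := by
  simp only [comp_hom, pure, Category.assoc, Functor.map_comp, M.μ_unit_left, Category.comp_id]
  rw [← M.η_natural]

/-- Pure 1-cells of isomorphisms of `C` are adjoint equivalences. -/
def pureEquivalence {A B : Kleisli M} (i : A.of ≅ B.of) : Bicategory.Equivalence A B where
  hom := pure i.hom
  inv := pure i.inv
  unit := (mkIso (λ_ (𝟙_ E)) (by
    exact (pure_comp_pure i.hom i.inv).trans (by simp))).symm
  counit := mkIso (λ_ (𝟙_ E)) (by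
    exact (pure_comp_pure i.inv i.hom).trans (by simp))
  left_triangle := by
    ext
    apply hom₂_ext
    simp [bicategoricalIsoComp, Bicategory.leftZigzagIso, BicategoricalCoherence.iso]
    change 𝟙_ E ◁ (λ_ (𝟙_ E)).inv ≫ (α_ (𝟙_ E) (𝟙_ E) (𝟙_ E)).inv ≫ (λ_ (𝟙_ E)).hom ▷ 𝟙_ E =
      (ρ_ (𝟙_ E)).hom ≫ (λ_ (𝟙_ E)).inv
    monoidal

variable (M) in
/-- The unit object and the structural 1-cells of the Kleisli bicategory: the pure 1-cells of the
unit object and the structural isomorphisms of `C`. -/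
def structural : StructuralEquivalences (binoidal M) where
  unit := ⟨𝟙_ C⟩
  lam X := pureEquivalence (λ_ X.of)
  rho X := pureEquivalence (ρ_ X.of)
  assoc X Y Z := pureEquivalence (α_ X.of Y.of Z.of)

/-- The canonical regrading `I ⊗ e ⟶ e ⊗ I`. -/
def unitSwap (e : E) : 𝟙_ E ⊗ e ⟶ e ⊗ 𝟙_ E := (λ_ e).hom ≫ (ρ_ e).inv

/-- The regradings underlying all 2-cells of a premonoidal structure on the Kleisli bicategory are
the canonical isomorphisms of `E`. As a 2-cell is determined by its regrading, this determines the
premonoidal structure. -/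
structure IsCanonical (P : PremonoidalStructure (structural M)) : Prop where
  lamNat {X Y : Kleisli M} (f : X ⟶ Y) : Hom₂.grade (P.lamNat f).hom = unitSwap f.grade
  rhoNat {X Y : Kleisli M} (f : X ⟶ Y) : Hom₂.grade (P.rhoNat f).hom = unitSwap f.grade
  nat₁ {X X' : Kleisli M} (f : X ⟶ X') (Y Z : Kleisli M) :
    Hom₂.grade (P.assocNat.nat₁ f Y Z).hom = unitSwap f.grade
  nat₂ (X : Kleisli M) {Y Y' : Kleisli M} (g : Y ⟶ Y') (Z : Kleisli M) :
    Hom₂.grade (P.assocNat.nat₂ X g Z).hom = unitSwap g.grade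
  nat₃ (X Y : Kleisli M) {Z Z' : Kleisli M} (h : Z ⟶ Z') :
    Hom₂.grade (P.assocNat.nat₃ X Y h).hom = unitSwap h.grade
  lam_lc (X : Kleisli M) {Y Y' : Kleisli M} (g : Y ⟶ Y') :
    Hom₂.grade ((P.lamCentral X).lc g).hom = unitSwap g.grade
  lam_rc (X : Kleisli M) {Y Y' : Kleisli M} (g : Y ⟶ Y') :
    Hom₂.grade ((P.lamCentral X).rc g).hom = unitSwap g.grade
  rho_lc (X : Kleisli M) {Y Y' : Kleisli M} (g : Y ⟶ Y') :
    Hom₂.grade ((P.rhoCentral X).lc g).hom = unitSwap g.grade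
  rho_rc (X : Kleisli M) {Y Y' : Kleisli M} (g : Y ⟶ Y') :
    Hom₂.grade ((P.rhoCentral X).rc g).hom = unitSwap g.grade
  assoc_lc (X Y Z : Kleisli M) {W W' : Kleisli M} (g : W ⟶ W') :
    Hom₂.grade ((P.assocCentral X Y Z).lc g).hom = unitSwap g.grade
  assoc_rc (X Y Z : Kleisli M) {W W' : Kleisli M} (g : W ⟶ W') :
    Hom₂.grade ((P.assocCentral X Y Z).rc g).hom = unitSwap g.grade
  p (X Y Z W : Kleisli M) : Hom₂.grade (P.p X Y Z W).hom = (λ_ (𝟙_ E)).hom ▷ 𝟙_ E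
  m (X Y : Kleisli M) : Hom₂.grade (P.m X Y).hom = (λ_ (𝟙_ E)).hom
  l (X Y : Kleisli M) : Hom₂.grade (P.l X Y).hom = (λ_ (𝟙_ E)).inv
  r (X Y : Kleisli M) : Hom₂.grade (P.r X Y).hom = (λ_ (𝟙_ E)).inv

end Kleisli

end Kleisli

end PremonoidalBicat

/-!
A 2-cell of the Kleisli bicategory is a morphism of grades with a property, so an equation between
2-cells is an equation between morphisms of `E` (`Kleisli.hom₂_ext`). Every 2-cell of the premonoidal
structure is regraded by a canonical isomorphism of `E`. What has to be shown therefore splits in two.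

*The canonical isomorphisms of `E` are 2-cells.* A square whose vertical sides are pure 1-cells
`i`, `j` and whose horizontal sides are `f : A ⟶ T_e B` and `g : A' ⟶ T_e B'` is filled by the
regrading `I ⊗ e ≅ e ⊗ I` as soon as `T_e(j) ∘ f = g ∘ i` in `C` (`Kleisli.swapSq`). For the
pseudonaturality of `λ`, `ρ`, `α` and the centrality of pure 1-cells these equations are naturality
and the axioms of the two strengths (namespace `Bistrength`); the naturality of `α` in its middle
argument is the compatibility of the two strengths. The 2-cells `p`, `m`, `l`, `r` go between
composites of pure 1-cells, and exist by the pentagon and the triangle equation in `C` and its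
consequences for `λ` and `ρ` (`Kleisli.purePentagon`, `Kleisli.pureTriangle`).

*The axioms hold.* Each axiom compares two composites of associators, unitors and, for naturality,
one arbitrary morphism of `E`, so it follows from coherence for monoidal categories. The only
regradings that are not immediate are those of the centrality witnesses of `X ⋊ f` and `f ⋉ X`,
which are defined by cancelling an equivalence: whiskering with the pure 1-cell of the associator
is tensoring with `I`, which is faithful, so these regradings are again `I ⊗ e ≅ e ⊗ I`
(`Kleisli.lwhisker_lc_grade` and the three lemmas after it).
-/

namespace PremonoidalBicat

open CategoryTheory MonoidalCategory

variable {E : Type u₁} [Category.{v₁} E] [MonoidalCategory E]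
  {C : Type u₂} [Category.{v₂} C] [MonoidalCategory C] {M : BistrongGradedMonad E C}

/-! ### Strengths and the structural isomorphisms -/

namespace Bistrength

variable {F : C ⥤ C} (S : Bistrength F)

theorem whiskerLeft_comp_t_comp_map {X X' Y Y' : C} (i : X ⟶ X') (g : Y ⟶ F.obj Y') :
    (X ◁ g ≫ S.t X Y') ≫ F.map (i ▷ Y') = i ▷ Y ≫ X' ◁ g ≫ S.t X' Y' := by
  have h := S.t_natural i (𝟙 Y')
  simp only [F.map_id, tensorHom_id] at h
  rw [Category.assoc, ← h, whisker_exchange_assoc]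

theorem whiskerRight_comp_s_comp_map {X X' Y Y' : C} (i : X ⟶ X') (g : Y ⟶ F.obj Y') :
    (g ▷ X ≫ S.s Y' X) ≫ F.map (Y' ◁ i) = Y ◁ i ≫ g ▷ X' ≫ S.s Y' X' := by
  have h := S.s_natural (𝟙 Y') i
  simp only [F.map_id, id_tensorHom] at h
  rw [Category.assoc, ← h, whisker_exchange_assoc]

theorem whiskerLeft_comp_t_comp_leftUnitor {X Y : C} (f : X ⟶ F.obj Y) :
    (𝟙_ C ◁ f ≫ S.t (𝟙_ C) Y) ≫ F.map (λ_ Y).hom = (λ_ X).hom ≫ f := by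
  rw [Category.assoc, S.t_unit, leftUnitor_naturality]

theorem whiskerRight_comp_s_comp_rightUnitor {X Y : C} (f : X ⟶ F.obj Y) :
    (f ▷ 𝟙_ C ≫ S.s Y (𝟙_ C)) ≫ F.map (ρ_ Y).hom = (ρ_ X).hom ≫ f := by
  rw [Category.assoc, S.s_unit, rightUnitor_naturality]

theorem whiskerRight_comp_s_comp_associator {X X' : C} (f : X ⟶ F.obj X') (Y Z : C) :
    ((f ▷ Y ≫ S.s X' Y) ▷ Z ≫ S.s (X' ⊗ Y) Z) ≫ F.map (α_ X' Y Z).hom =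
      (α_ X Y Z).hom ≫ f ▷ (Y ⊗ Z) ≫ S.s X' (Y ⊗ Z) := by
  simp only [MonoidalCategory.comp_whiskerRight, Category.assoc, S.s_assoc]
  simp

theorem whiskerLeft_comp_t_whiskerRight_comp_s_comp_associator (X : C) {Y Y' : C}
    (g : Y ⟶ F.obj Y') (Z : C) :
    ((X ◁ g ≫ S.t X Y') ▷ Z ≫ S.s (X ⊗ Y') Z) ≫ F.map (α_ X Y' Z).hom =
      (α_ X Y Z).hom ≫ X ◁ (g ▷ Z ≫ S.s Y' Z) ≫ S.t X (Y' ⊗ Z) := by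
  simp only [MonoidalCategory.comp_whiskerRight, Category.assoc, S.compat]
  simp

theorem whiskerLeft_comp_t_comp_associator (X Y : C) {Z Z' : C} (h : Z ⟶ F.obj Z') :
    ((X ⊗ Y) ◁ h ≫ S.t (X ⊗ Y) Z') ≫ F.map (α_ X Y Z').hom =
      (α_ X Y Z).hom ≫ X ◁ (Y ◁ h ≫ S.t Y Z') ≫ S.t X (Y ⊗ Z') := by
  simp only [Category.assoc, S.t_assoc]
  simp

end Bistrength

namespace Kleisli

/-! ### Coherence for regradings -/

/-- The canonical regrading `I ⊗ e ⟶ e ⊗ I` as an isomorphism. -/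
def unitSwapIso (e : E) : 𝟙_ E ⊗ e ≅ e ⊗ 𝟙_ E := λ_ e ≪≫ (ρ_ e).symm

theorem unitSwap_naturality {e e' : E} (γ : e ⟶ e') :
    𝟙_ E ◁ γ ≫ unitSwap e' = unitSwap e ≫ γ ▷ 𝟙_ E := by
  simp [unitSwap]

/-- The unit law of pseudonaturality for squares regraded by `unitSwap`; `p` and `q` underlie the
unit constraints of the two pseudofunctors, which are strict only up to composites of identities. -/
theorem unitSwap_unit {p q : 𝟙_ E ⟶ 𝟙_ E} (hp : p = 𝟙 _) (hq : q = 𝟙 _) :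
    unitSwap (𝟙_ E) ≫ q ▷ 𝟙_ E = 𝟙_ E ◁ p ≫ (ρ_ (𝟙_ E)).hom ≫ (λ_ (𝟙_ E)).inv := by
  subst hp hq
  simp [unitSwap, unitors_equal, unitors_inv_equal]

/-- The composition law of pseudonaturality for squares regraded by `unitSwap`; `p` and `q` underlie
the composition constraints of the two pseudofunctors. -/
theorem unitSwap_tensor {e e' : E} {p q : e' ⊗ e ⟶ e' ⊗ e} (hp : p = 𝟙 _) (hq : q = 𝟙 _) :
    unitSwap (e' ⊗ e) ≫ q ▷ 𝟙_ E =
      𝟙_ E ◁ p ≫ (α_ (𝟙_ E) e' e).inv ≫ unitSwap e' ▷ e ≫ (α_ e' (𝟙_ E) e).hom ≫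
        e' ◁ unitSwap e ≫ (α_ e' e (𝟙_ E)).inv := by
  subst hp hq
  simp [unitSwap]

/-- The regrading that underlies `Sq.paste`. -/
abbrev pasteSwap {e r r' : E} (s : r ⊗ e ⟶ e ⊗ r) (s' : r' ⊗ e ⟶ e ⊗ r') :
    (r' ⊗ r) ⊗ e ⟶ e ⊗ (r' ⊗ r) :=
  (α_ r' r e).hom ≫ r' ◁ s ≫ (α_ r' e r).inv ≫ s' ▷ r ≫ (α_ e r' r).hom

theorem pasteSwap_congr {e r r' : E} {s t : r ⊗ e ⟶ e ⊗ r} {s' t' : r' ⊗ e ⟶ e ⊗ r'}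
    (h : s = t) (h' : s' = t') : pasteSwap s s' = pasteSwap t t' := by rw [h, h']

/-- Conjugating a square (`Sq.conj`) by 2-cells with identity regradings does not change its
regrading. -/
theorem conj_regrading {e r : E} {s t : r ⊗ e ⟶ e ⊗ r} (h : s = t) :
    𝟙 r ▷ e ≫ s ≫ e ◁ 𝟙 r = t := by simp [h]

omit [MonoidalCategory E] in
/-- The image of a square under a strict pseudofunctor (`Sq.map`) has the same regrading. -/
theorem map_regrading {e e' : E} (γ : e ⟶ e') : 𝟙 e ≫ γ ≫ 𝟙 e' = γ := by simp

/-- The regrading that underlies `PseudofunctorOn.map₃₂` for a strict pseudofunctor. -/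
theorem map₃₂_regrading {a b c d : E} (γ : (a ⊗ b) ⊗ c ⟶ d) :
    (𝟙 (a ⊗ b) ▷ c ≫ 𝟙 ((a ⊗ b) ⊗ c)) ≫ γ ≫ 𝟙 d = γ := by simp

theorem rightUnitor_inv_comp_rightUnitor_inv_comp_leftUnitor_whiskerRight :
    (ρ_ (𝟙_ E)).inv ≫ (ρ_ (𝟙_ E ⊗ 𝟙_ E)).inv ≫ (λ_ (𝟙_ E)).hom ▷ 𝟙_ E = (ρ_ (𝟙_ E)).inv := by
  monoidal

/-- The regrading of the pasting of five faces in `fillRight`, when all faces are regraded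
canonically. -/
theorem fillRight_regrading {e : E} {s : 𝟙_ E ⊗ e ⟶ e ⊗ 𝟙_ E} (hs : s = unitSwap e) :
    (α_ (𝟙_ E) (𝟙_ E) e).inv ≫ unitSwap (𝟙_ E) ▷ e ≫ (α_ (𝟙_ E) (𝟙_ E) e).hom ≫
      𝟙_ E ◁ unitSwap e ≫ (α_ (𝟙_ E) e (𝟙_ E)).inv ≫ s ▷ 𝟙_ E ≫ (α_ e (𝟙_ E) (𝟙_ E)).hom ≫
        e ◁ (unitSwapIso (𝟙_ E)).inv ≫ (α_ e (𝟙_ E) (𝟙_ E)).inv ≫ (unitSwapIso e).inv ▷ 𝟙_ E ≫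
          (α_ (𝟙_ E) e (𝟙_ E)).hom = 𝟙_ E ◁ unitSwap e := by
  subst hs
  dsimp [unitSwap, unitSwapIso]
  monoidal

/-- The regrading of the pasting of five faces in `fillLeft`, when all faces are regraded
canonically. -/
theorem fillLeft_regrading {e : E} {s : 𝟙_ E ⊗ e ⟶ e ⊗ 𝟙_ E} (hs : s = unitSwap e) :
    (α_ (𝟙_ E) e (𝟙_ E)).hom ≫ 𝟙_ E ◁ (unitSwapIso e).inv ≫ (α_ (𝟙_ E) (𝟙_ E) e).inv ≫
      (unitSwapIso (𝟙_ E)).inv ▷ e ≫ (α_ (𝟙_ E) (𝟙_ E) e).hom ≫ 𝟙_ E ◁ s ≫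
        (α_ (𝟙_ E) e (𝟙_ E)).inv ≫ unitSwap e ▷ 𝟙_ E ≫ (α_ e (𝟙_ E) (𝟙_ E)).hom ≫
          e ◁ unitSwap (𝟙_ E) ≫ (α_ e (𝟙_ E) (𝟙_ E)).inv = unitSwap e ▷ 𝟙_ E := by
  subst hs
  dsimp [unitSwap, unitSwapIso]
  monoidal

/-- The modification equation for a 2-cell from a composite of two pure 1-cells to one pure
1-cell. -/
theorem modif_regrading_two_one {e : E} {s : (𝟙_ E ⊗ 𝟙_ E) ⊗ e ⟶ e ⊗ (𝟙_ E ⊗ 𝟙_ E)}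
    {t : 𝟙_ E ⊗ e ⟶ e ⊗ 𝟙_ E}
    (hs : s = pasteSwap (unitSwap e) (unitSwap e)) (ht : t = unitSwap e) :
    (λ_ (𝟙_ E)).hom ▷ e ≫ t = s ≫ e ◁ (λ_ (𝟙_ E)).hom := by
  subst hs ht
  dsimp [unitSwap]
  monoidal

/-- The modification equation for a 2-cell from one pure 1-cell to a composite of two pure
1-cells. -/
theorem modif_regrading_one_two {e : E} {s : (𝟙_ E ⊗ 𝟙_ E) ⊗ e ⟶ e ⊗ (𝟙_ E ⊗ 𝟙_ E)}
    {t : 𝟙_ E ⊗ e ⟶ e ⊗ 𝟙_ E}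
    (ht : t = unitSwap e) (hs : s = pasteSwap (unitSwap e) (unitSwap e)) :
    (λ_ (𝟙_ E)).inv ▷ e ≫ s = t ≫ e ◁ (λ_ (𝟙_ E)).inv := by
  subst hs ht
  dsimp [unitSwap]
  monoidal

/-- The modification equation for a 2-cell from a composite of three pure 1-cells to a composite of
two pure 1-cells. -/
theorem modif_regrading_three_two {e : E}
    {s : ((𝟙_ E ⊗ 𝟙_ E) ⊗ 𝟙_ E) ⊗ e ⟶ e ⊗ ((𝟙_ E ⊗ 𝟙_ E) ⊗ 𝟙_ E)}
    {t : (𝟙_ E ⊗ 𝟙_ E) ⊗ e ⟶ e ⊗ (𝟙_ E ⊗ 𝟙_ E)}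
    (hs : s = pasteSwap (unitSwap e) (pasteSwap (unitSwap e) (unitSwap e)))
    (ht : t = pasteSwap (unitSwap e) (unitSwap e)) :
    ((λ_ (𝟙_ E)).hom ▷ 𝟙_ E) ▷ e ≫ t = s ≫ e ◁ ((λ_ (𝟙_ E)).hom ▷ 𝟙_ E) := by
  subst hs ht
  dsimp [unitSwap]
  monoidal

/-! ### Squares and composites of pure 1-cells -/

/-- `Hom.mk`, typed as a 1-cell of the Kleisli bicategory. -/
abbrev cell {A B : Kleisli M} (e : E) (f : A.of ⟶ (M.F e).obj B.of) : A ⟶ B := Hom.mk e f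

theorem comp_hom_of_left {A B D : Kleisli M} {l : A.of ⟶ (M.F (𝟙_ E)).obj B.of}
    {i : A.of ⟶ B.of} (hl : l = i ≫ M.η B.of) (k : B ⟶ D) :
    Hom.hom (cell (𝟙_ E) l ≫ k) = i ≫ Hom.hom k ≫ M.reg (ρ_ (Hom.grade k)).inv D.of := by
  subst hl
  rw [← cancel_mono (M.reg (ρ_ (Hom.grade k)).hom _)]
  simp only [comp_hom, Category.assoc, ← M.reg_comp, Iso.inv_hom_id, M.reg_id, Category.comp_id]
  rw [← reassoc_of% M.η_natural, M.μ_unit_right, Category.comp_id]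

theorem comp_hom_of_right {A B D : Kleisli M} (k : A ⟶ B) {r : B.of ⟶ (M.F (𝟙_ E)).obj D.of}
    {j : B.of ⟶ D.of} (hr : r = j ≫ M.η D.of) :
    Hom.hom (k ≫ cell (𝟙_ E) r) =
      Hom.hom k ≫ (M.F (Hom.grade k)).map j ≫ M.reg (λ_ (Hom.grade k)).inv D.of := by
  subst hr
  rw [← cancel_mono (M.reg (λ_ (Hom.grade k)).hom _)]
  simp only [comp_hom, Category.assoc, ← M.reg_comp, Iso.inv_hom_id, M.reg_id, Category.comp_id,
    Functor.map_comp, M.μ_unit_left]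

/-- A square in `C` with sides `i`, `j`, `top`, `bot` gives a square of 1-cells with pure vertical
sides, regraded by `unitSwap`. The vertical 1-cells are only required to be equal to `pure i` and
`pure j`, as this equality is not definitional for `X ⋊ pure i` and `pure i ⋉ Y`. -/
def swapSq {A B A' B' : Kleisli M} {e : E} {top : A.of ⟶ (M.F e).obj B.of}
    {bot : A'.of ⟶ (M.F e).obj B'.of} {l : A.of ⟶ (M.F (𝟙_ E)).obj A'.of}
    {r : B.of ⟶ (M.F (𝟙_ E)).obj B'.of} {i : A.of ⟶ A'.of} {j : B.of ⟶ B'.of}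
    (hl : l = i ≫ M.η _) (hr : r = j ≫ M.η _) (h : top ≫ (M.F e).map j = i ≫ bot) :
    Sq (cell e top) (cell (𝟙_ E) l) (cell (𝟙_ E) r) (cell e bot) :=
  mkIso (unitSwapIso e) (by
    rw [comp_hom_of_left hl, comp_hom_of_right _ hr]
    dsimp only [unitSwapIso, Iso.trans_hom, Iso.symm_hom]
    rw [M.reg_comp]
    simp only [Category.assoc]
    rw [← reassoc_of% M.reg_comp, Iso.inv_hom_id, M.reg_id, Category.id_comp, reassoc_of% h])

/-- A commutative triangle in `C` gives an invertible 2-cell between the pure 1-cells. -/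
def pureTriangle {A B D : Kleisli M} {f : A.of ⟶ (M.F (𝟙_ E)).obj B.of}
    {g : B.of ⟶ (M.F (𝟙_ E)).obj D.of} {k : A.of ⟶ (M.F (𝟙_ E)).obj D.of}
    {i : A.of ⟶ B.of} {j : B.of ⟶ D.of} {n : A.of ⟶ D.of} (hf : f = i ≫ M.η _)
    (hg : g = j ≫ M.η _) (hk : k = n ≫ M.η _) (h : i ≫ j = n) :
    cell (𝟙_ E) f ≫ cell (𝟙_ E) g ≅ cell (𝟙_ E) k :=
  mkIso (λ_ (𝟙_ E)) (by
    subst hf hg hk h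
    exact (pure_comp_pure i j).trans (Category.assoc _ _ _).symm)

/-- A commutative pentagon in `C` gives an invertible 2-cell between the pure 1-cells. -/
def purePentagon {A B D A' D' : Kleisli M} {f : A.of ⟶ (M.F (𝟙_ E)).obj B.of}
    {g : B.of ⟶ (M.F (𝟙_ E)).obj D.of} {h : D.of ⟶ (M.F (𝟙_ E)).obj D'.of}
    {k : A.of ⟶ (M.F (𝟙_ E)).obj A'.of} {l : A'.of ⟶ (M.F (𝟙_ E)).obj D'.of}
    {i : A.of ⟶ B.of} {j : B.of ⟶ D.of} {n : D.of ⟶ D'.of} {p : A.of ⟶ A'.of}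
    {q : A'.of ⟶ D'.of} (hf : f = i ≫ M.η _) (hg : g = j ≫ M.η _) (hh : h = n ≫ M.η _)
    (hk : k = p ≫ M.η _) (hl : l = q ≫ M.η _) (w : i ≫ j ≫ n = p ≫ q) :
    cell (𝟙_ E) f ≫ cell (𝟙_ E) g ≫ cell (𝟙_ E) h ≅ cell (𝟙_ E) k ≫ cell (𝟙_ E) l :=
  mkIso (whiskerRightIso (λ_ (𝟙_ E)) (𝟙_ E)) (by
    rw [comp_hom_of_left hf, comp_hom_of_left hg, comp_hom_of_left hk]
    subst hh hl
    dsimp only [whiskerRightIso_hom, comp_grade]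
    simp only [Category.assoc, ← M.reg_comp]
    rw [reassoc_of% w]
    congr 4
    exact rightUnitor_inv_comp_rightUnitor_inv_comp_leftUnitor_whiskerRight)

theorem pure_whiskerLeft (X : C) {A B : C} (i : A ⟶ B) :
    X ◁ (i ≫ M.η B) ≫ (M.str (𝟙_ E)).t X B = X ◁ i ≫ M.η (X ⊗ B) := by
  rw [MonoidalCategory.whiskerLeft_comp, Category.assoc, M.t_η]

theorem pure_whiskerRight {A B : C} (i : A ⟶ B) (X : C) :
    (i ≫ M.η B) ▷ X ≫ (M.str (𝟙_ E)).s B X = i ▷ X ≫ M.η (B ⊗ X) := by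
  rw [MonoidalCategory.comp_whiskerRight, Category.assoc, M.s_η]

/-! ### Pseudonaturality and centrality of the structural 1-cells -/

/-- The pseudonaturality 2-cell of `λ`. -/
def lamSq {X Y : Kleisli M} (f : X ⟶ Y) :
    Sq ((binoidal M).lw (structural M).unit f) ((structural M).l X) ((structural M).l Y) f :=
  swapSq rfl rfl ((M.str _).whiskerLeft_comp_t_comp_leftUnitor _)

/-- The pseudonaturality 2-cell of `ρ`. -/
def rhoSq {X Y : Kleisli M} (f : X ⟶ Y) :
    Sq ((binoidal M).rw f (structural M).unit) ((structural M).r X) ((structural M).r Y) f :=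
  swapSq rfl rfl ((M.str _).whiskerRight_comp_s_comp_rightUnitor _)

theorem isPseudonatural_lam : IsPseudonatural ((binoidal M).leftF (structural M).unit)
    (Pseudofunctor.id (Kleisli M)) (fun X => (structural M).l X) (fun f => lamSq f) where
  naturality_naturality _ := hom₂_ext (unitSwap_naturality _)
  naturality_id _ := hom₂_ext (unitSwap_unit rfl rfl)
  naturality_comp _ _ := hom₂_ext (unitSwap_tensor rfl rfl)

theorem isPseudonatural_rho : IsPseudonatural ((binoidal M).rightF (structural M).unit)
    (Pseudofunctor.id (Kleisli M)) (fun X => (structural M).r X) (fun f => rhoSq f) where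
  naturality_naturality _ := hom₂_ext (unitSwap_naturality _)
  naturality_id _ := hom₂_ext (unitSwap_unit rfl rfl)
  naturality_comp _ _ := hom₂_ext (unitSwap_tensor rfl rfl)

variable (M) in
/-- The pseudonaturality of `α` in each argument. -/
def assocNat : AssociatorNaturality (structural M) where
  nat₁ _ Y Z := swapSq rfl rfl ((M.str _).whiskerRight_comp_s_comp_associator _ Y.of Z.of)
  nat₂ X _ _ _ Z := swapSq rfl rfl
    ((M.str _).whiskerLeft_comp_t_whiskerRight_comp_s_comp_associator X.of _ Z.of)
  nat₃ X Y _ _ _ := swapSq rfl rfl ((M.str _).whiskerLeft_comp_t_comp_associator X.of Y.of _)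
  -- The constraints of a composite of two pseudofunctors are regraded by `𝟙 ≫ 𝟙`.
  pseudo₁ _ _ :=
    { naturality_naturality _ := hom₂_ext (unitSwap_naturality _)
      naturality_id _ := hom₂_ext (unitSwap_unit (Category.comp_id _) rfl)
      naturality_comp _ _ := hom₂_ext (unitSwap_tensor (Category.comp_id _) rfl) }
  pseudo₂ _ _ :=
    { naturality_naturality _ := hom₂_ext (unitSwap_naturality _)
      naturality_id _ := hom₂_ext (unitSwap_unit (Category.comp_id _) (Category.comp_id _))
      naturality_comp _ _ :=
        hom₂_ext (unitSwap_tensor (Category.comp_id _) (Category.comp_id _)) }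
  pseudo₃ _ _ :=
    { naturality_naturality _ := hom₂_ext (unitSwap_naturality _)
      naturality_id _ := hom₂_ext (unitSwap_unit rfl (Category.comp_id _))
      naturality_comp _ _ := hom₂_ext (unitSwap_tensor rfl (Category.comp_id _)) }

/-- Pure 1-cells are central, by the naturality of the strengths. -/
def pureCentral {X X' : Kleisli M} (i : X.of ⟶ X'.of) :
    Central (binoidal M) (pure i : X ⟶ X') where
  lc {Y Y'} _ := swapSq (pure_whiskerRight i Y.of) (pure_whiskerRight i Y'.of)
    ((M.str _).whiskerLeft_comp_t_comp_map i _)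
  rc {Y Y'} _ := swapSq (pure_whiskerLeft Y.of i) (pure_whiskerLeft Y'.of i)
    ((M.str _).whiskerRight_comp_s_comp_map i _)
  lc_pseudo :=
    { naturality_naturality _ := hom₂_ext (unitSwap_naturality _)
      naturality_id _ := hom₂_ext (unitSwap_unit rfl rfl)
      naturality_comp _ _ := hom₂_ext (unitSwap_tensor rfl rfl) }
  rc_pseudo :=
    { naturality_naturality _ := hom₂_ext (unitSwap_naturality _)
      naturality_id _ := hom₂_ext (unitSwap_unit rfl rfl)
      naturality_comp _ _ := hom₂_ext (unitSwap_tensor rfl rfl) }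

/-! ### Centrality witnesses of whiskered 1-cells -/

theorem grade_cancelRight {A B D : Kleisli M} (e : Bicategory.Equivalence B D)
    {f g : A ⟶ B} (θ : f ≫ e.hom ≅ g ≫ e.hom) :
    Hom.grade e.hom ◁ Hom₂.grade (cancelRight e θ).hom = Hom₂.grade θ.hom :=
  congrArg (fun x => Hom₂.grade (Iso.hom x)) (whisker_cancelRight e θ)

theorem grade_cancelLeft {A B D : Kleisli M} (e : Bicategory.Equivalence A B)
    {f g : B ⟶ D} (θ : e.hom ≫ f ≅ e.hom ≫ g) :
    Hom₂.grade (cancelLeft e θ).hom ▷ Hom.grade e.hom = Hom₂.grade θ.hom :=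
  congrArg (fun x => Hom₂.grade (Iso.hom x)) (whisker_cancelLeft e θ)

section Whisker

variable (X : Kleisli M) {A A' Y Y' : Kleisli M} (i : A.of ⟶ A'.of) (g : Y ⟶ Y')

theorem lwhisker_lc_grade :
    Hom₂.grade (((pureCentral i).lwhisker (assocNat M) X).lc g).hom = unitSwap g.grade :=
  (whiskerLeft_iff (C := E) _ _).1 ((grade_cancelRight ((structural M).assoc X A' Y') _).trans
    (fillRight_regrading (map_regrading _)))

theorem lwhisker_rc_grade :
    Hom₂.grade (((pureCentral i).lwhisker (assocNat M) X).rc g).hom = unitSwap g.grade :=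
  (whiskerRight_iff (C := E) _ _).1 ((grade_cancelLeft ((structural M).assoc Y X A) _).trans
    (fillLeft_regrading rfl))

theorem rwhisker_lc_grade :
    Hom₂.grade (((pureCentral i).rwhisker (assocNat M) X).lc g).hom = unitSwap g.grade :=
  (whiskerLeft_iff (C := E) _ _).1 ((grade_cancelRight ((structural M).assoc A' X Y') _).trans
    (fillRight_regrading rfl))

theorem rwhisker_rc_grade :
    Hom₂.grade (((pureCentral i).rwhisker (assocNat M) X).rc g).hom = unitSwap g.grade :=
  (whiskerRight_iff (C := E) _ _).1 ((grade_cancelLeft ((structural M).assoc Y A X) _).trans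
    (fillLeft_regrading (map_regrading _)))

end Whisker

/-! ### The structural 2-cells -/

/-- The 2-cell `p`, from the pentagon equation in `C`. -/
def pCell (X Y Z W : Kleisli M) :
    (binoidal M).rw ((structural M).a X Y Z) W ≫
        (structural M).a X ((binoidal M).tensorObj Y Z) W ≫
          (binoidal M).lw X ((structural M).a Y Z W) ≅
      (structural M).a ((binoidal M).tensorObj X Y) Z W ≫
        (structural M).a X Y ((binoidal M).tensorObj Z W) :=
  purePentagon (pure_whiskerRight _ _) rfl (pure_whiskerLeft _ _) rfl rfl
    (pentagon X.of Y.of Z.of W.of)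

/-- The 2-cell `m`, from the triangle equation in `C`. -/
def mCell (X Y : Kleisli M) :
    (structural M).a X (structural M).unit Y ≫ (binoidal M).lw X ((structural M).l Y) ≅
      (binoidal M).rw ((structural M).r X) Y :=
  pureTriangle rfl (pure_whiskerLeft _ _) (pure_whiskerRight _ _) (triangle X.of Y.of)

/-- The 2-cell `l`, from the equation for `λ` at a tensor product in `C`. -/
def lCell (X Y : Kleisli M) :
    (binoidal M).rw ((structural M).l X) Y ≅
      (structural M).a (structural M).unit X Y ≫ (structural M).l ((binoidal M).tensorObj X Y) :=
  (pureTriangle rfl rfl (pure_whiskerRight _ _)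
    ((Iso.eq_inv_comp _).1 (leftUnitor_tensor_hom X.of Y.of))).symm

/-- The 2-cell `r`, from the equation for `ρ` at a tensor product in `C`. -/
def rCell (X Y : Kleisli M) :
    (structural M).r ((binoidal M).tensorObj X Y) ≅
      (structural M).a X Y (structural M).unit ≫ (binoidal M).lw X ((structural M).r Y) :=
  (pureTriangle rfl (pure_whiskerLeft _ _) rfl (rightUnitor_tensor_hom X.of Y.of).symm).symm

/-! ### Regradings underlying the structure -/

@[simp] theorem lw_grade (X : Kleisli M) {Y Y' : Kleisli M} (g : Y ⟶ Y') :
    Hom.grade ((binoidal M).lw X g) = Hom.grade g := rfl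

@[simp] theorem rw_grade {X X' : Kleisli M} (f : X ⟶ X') (Y : Kleisli M) :
    Hom.grade ((binoidal M).rw f Y) = Hom.grade f := rfl

@[simp] theorem structural_l_grade (X : Kleisli M) :
    Hom.grade ((structural M).l X) = 𝟙_ E := rfl

@[simp] theorem structural_r_grade (X : Kleisli M) :
    Hom.grade ((structural M).r X) = 𝟙_ E := rfl

@[simp] theorem structural_a_grade (X Y Z : Kleisli M) :
    Hom.grade ((structural M).a X Y Z) = 𝟙_ E := rfl

@[simp] theorem pCell_hom_grade (X Y Z W : Kleisli M) :
    Hom₂.grade (pCell X Y Z W).hom = (λ_ (𝟙_ E)).hom ▷ 𝟙_ E := rfl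

@[simp] theorem mCell_hom_grade (X Y : Kleisli M) :
    Hom₂.grade (mCell X Y).hom = (λ_ (𝟙_ E)).hom := rfl

@[simp] theorem lCell_inv_grade (X Y : Kleisli M) :
    Hom₂.grade (lCell X Y).inv = (λ_ (𝟙_ E)).hom := rfl

@[simp] theorem rCell_inv_grade (X Y : Kleisli M) :
    Hom₂.grade (rCell X Y).inv = (λ_ (𝟙_ E)).hom := rfl

@[simp] theorem lamSq_hom_grade {X Y : Kleisli M} (f : X ⟶ Y) :
    Hom₂.grade (lamSq f).hom = unitSwap (Hom.grade f) := rfl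

@[simp] theorem rhoSq_hom_grade {X Y : Kleisli M} (f : X ⟶ Y) :
    Hom₂.grade (rhoSq f).hom = unitSwap (Hom.grade f) := rfl

@[simp] theorem assocNat_nat₁_hom_grade {X X' : Kleisli M} (f : X ⟶ X') (Y Z : Kleisli M) :
    Hom₂.grade ((assocNat M).nat₁ f Y Z).hom = unitSwap (Hom.grade f) := rfl

@[simp] theorem assocNat_nat₂_hom_grade (X : Kleisli M) {Y Y' : Kleisli M} (g : Y ⟶ Y')
    (Z : Kleisli M) :
    Hom₂.grade ((assocNat M).nat₂ X g Z).hom = unitSwap (Hom.grade g) := rfl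

@[simp] theorem assocNat_nat₂_inv_grade (X : Kleisli M) {Y Y' : Kleisli M} (g : Y ⟶ Y')
    (Z : Kleisli M) :
    Hom₂.grade ((assocNat M).nat₂ X g Z).inv = (unitSwapIso (Hom.grade g)).inv := rfl

@[simp] theorem assocNat_nat₃_inv_grade (X Y : Kleisli M) {Z Z' : Kleisli M} (h : Z ⟶ Z') :
    Hom₂.grade ((assocNat M).nat₃ X Y h).inv = (unitSwapIso (Hom.grade h)).inv := rfl

section Map

variable (X : Kleisli M) {A B D K L : Kleisli M} {f : A ⟶ B} {g : B ⟶ D}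

@[simp] theorem left_map₂₁_grade {k : A ⟶ D} (θ : f ≫ g ≅ k) :
    Hom₂.grade (((binoidal M).left X).map₂₁ θ).hom = Hom₂.grade θ.hom := Category.id_comp _

@[simp] theorem right_map₂₁_grade {k : A ⟶ D} (θ : f ≫ g ≅ k) :
    Hom₂.grade (((binoidal M).right X).map₂₁ θ).hom = Hom₂.grade θ.hom := Category.id_comp _

@[simp] theorem left_map₃₂_grade {h : D ⟶ K} {k : A ⟶ L} {l : L ⟶ K} (θ : f ≫ g ≫ h ≅ k ≫ l) :
    Hom₂.grade (((binoidal M).left X).map₃₂ θ).hom = Hom₂.grade θ.hom := map₃₂_regrading _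

@[simp] theorem right_map₃₂_grade {h : D ⟶ K} {k : A ⟶ L} {l : L ⟶ K} (θ : f ≫ g ≫ h ≅ k ≫ l) :
    Hom₂.grade (((binoidal M).right X).map₃₂ θ).hom = Hom₂.grade θ.hom := map₃₂_regrading _

end Map

/-! ### The premonoidal structure -/

variable (M) in
/-- The canonical premonoidal structure of the Kleisli bicategory. -/
def premonoidalStructure : PremonoidalStructure (structural M) where
  lamNat := lamSq
  lam_pseudo := isPseudonatural_lam
  rhoNat := rhoSq
  rho_pseudo := isPseudonatural_rho
  assocNat := assocNat M
  lamCentral X := pureCentral (λ_ X.of).hom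
  rhoCentral X := pureCentral (ρ_ X.of).hom
  assocCentral X Y Z := pureCentral (α_ X.of Y.of Z.of).hom
  p := pCell
  m := mCell
  l := lCell
  r := rCell
  p_central _ _ _ _ :=
    ⟨fun _ => hom₂_ext (modif_regrading_three_two
      (conj_regrading (pasteSwap_congr (rwhisker_lc_grade _ _ _)
        (conj_regrading (pasteSwap_congr rfl (lwhisker_lc_grade _ _ _)))))
      (conj_regrading rfl)),
    fun _ => hom₂_ext (modif_regrading_three_two
      (conj_regrading (pasteSwap_congr (rwhisker_rc_grade _ _ _)
        (conj_regrading (pasteSwap_congr rfl (lwhisker_rc_grade _ _ _)))))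
      (conj_regrading rfl))⟩
  m_central _ _ :=
    ⟨fun _ => hom₂_ext (modif_regrading_two_one
      (conj_regrading (pasteSwap_congr rfl (lwhisker_lc_grade _ _ _)))
      (rwhisker_lc_grade _ _ _)),
    fun _ => hom₂_ext (modif_regrading_two_one
      (conj_regrading (pasteSwap_congr rfl (lwhisker_rc_grade _ _ _)))
      (rwhisker_rc_grade _ _ _))⟩
  l_central _ _ :=
    ⟨fun _ => hom₂_ext (modif_regrading_one_two (rwhisker_lc_grade _ _ _) (conj_regrading rfl)),
    fun _ => hom₂_ext (modif_regrading_one_two (rwhisker_rc_grade _ _ _) (conj_regrading rfl))⟩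
  r_central _ _ :=
    ⟨fun _ => hom₂_ext (modif_regrading_one_two rfl
      (conj_regrading (pasteSwap_congr rfl (lwhisker_lc_grade _ _ _)))),
    fun _ => hom₂_ext (modif_regrading_one_two rfl
      (conj_regrading (pasteSwap_congr rfl (lwhisker_rc_grade _ _ _))))⟩
  p_modif₁ _ _ _ _ :=
    hom₂_ext (modif_regrading_three_two (pasteSwap_congr (map_regrading _) rfl) rfl)
  p_modif₂ _ _ _ _ _ _ := hom₂_ext (modif_regrading_three_two
    (pasteSwap_congr (map_regrading _) (pasteSwap_congr rfl (map_regrading _))) rfl)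
  p_modif₃ _ _ _ _ _ _ := hom₂_ext (modif_regrading_three_two
    (pasteSwap_congr (map_regrading _) (pasteSwap_congr rfl (map_regrading _))) rfl)
  p_modif₄ _ _ _ _ _ _ := hom₂_ext (modif_regrading_three_two
    (pasteSwap_congr rfl (pasteSwap_congr rfl (map_regrading _))) rfl)
  m_modif₁ _ _ := hom₂_ext (modif_regrading_two_one rfl (map_regrading _))
  m_modif₂ _ _ _ _ :=
    hom₂_ext (modif_regrading_two_one (pasteSwap_congr rfl (map_regrading _)) rfl)
  l_modif₁ _ _ := hom₂_ext (modif_regrading_one_two (map_regrading _) rfl)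
  l_modif₂ _ _ _ _ := hom₂_ext (modif_regrading_one_two rfl rfl)
  r_modif₁ _ _ := hom₂_ext (modif_regrading_one_two rfl rfl)
  r_modif₂ _ _ _ _ :=
    hom₂_ext (modif_regrading_one_two rfl (pasteSwap_congr rfl (map_regrading _)))
  -- All 1-cells in the remaining equations are pure, so both sides are composites of structural
  -- isomorphisms of `E`.
  associahedron _ _ _ _ _ := by
    refine Iso.ext (hom₂_ext ?_)
    simp [bicategoricalIsoComp, BicategoricalCoherence.iso, unitSwap, unitSwapIso]
    monoidal
  unit₁ _ _ _ := by
    refine Iso.ext (hom₂_ext ?_)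
    simp [bicategoricalIsoComp, BicategoricalCoherence.iso, unitSwap]
    monoidal
  unit₂ _ _ _ := by
    refine Iso.ext (hom₂_ext ?_)
    simp [bicategoricalIsoComp, BicategoricalCoherence.iso, unitSwap, unitSwapIso]
  unit₃ _ _ _ := by
    refine Iso.ext (hom₂_ext ?_)
    simp [bicategoricalIsoComp, BicategoricalCoherence.iso, unitSwapIso]
    monoidal
  unit₄ _ _ _ := by
    refine Iso.ext (hom₂_ext ?_)
    simp [bicategoricalIsoComp, BicategoricalCoherence.iso, unitSwap, unitSwapIso]
    monoidal

end Kleisli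

end PremonoidalBicat

theorem mainTheorem6 {E : Type u₁} [CategoryTheory.Category.{v₁} E]
    [CategoryTheory.MonoidalCategory E] {C : Type u₂} [CategoryTheory.Category.{v₂} C]
    [CategoryTheory.MonoidalCategory C] (M : PremonoidalBicat.BistrongGradedMonad E C) :
    ∃ P : PremonoidalBicat.PremonoidalStructure (PremonoidalBicat.Kleisli.structural M),
      PremonoidalBicat.Kleisli.IsCanonical P :=
  ⟨PremonoidalBicat.Kleisli.premonoidalStructure M,
    { lamNat _ := rfl
      rhoNat _ := rfl
      nat₁ _ _ _ := rfl
      nat₂ _ _ _ _ _ := rfl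
      nat₃ _ _ _ _ _ := rfl
      lam_lc _ _ _ _ := rfl
      lam_rc _ _ _ _ := rfl
      rho_lc _ _ _ _ := rfl
      rho_rc _ _ _ _ := rfl
      assoc_lc _ _ _ _ _ _ := rfl
      assoc_rc _ _ _ _ _ _ := rfl
      p _ _ _ _ := rfl
      m _ _ := rfl
      l _ _ := rfl
      r _ _ := rfl }⟩
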